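/- **Setting.** Let $d\ge 1$ and let $\Omega\subset\mathbb R^d$ be open, bounded and connected with Lipschitz boundary; let $\Sigma_{\mathrm v},\Sigma_{\mathrm p}\subset\partial\Omega$ be disjoint and relatively open with $\partial\Omega=\overline{\Sigma_{\mathrm v}\cup\Sigma_{\mathrm p}}$. Let $r\ge 2$ and $s=r/(r-1)$. Let $\varphi_1$ be continuous, non-negative and non-decreasing on $[0,1]$ and positive on $(0,1)$, let $\varphi_2$ be continuous and non-decreasing on $[1,\infty)$, and suppose that there are $c,C>0$ with $$c\,a^{\frac{r-2}{2}}\le \varphi_2(a)\le C\bigl(1+a^{\frac{r-2}{2}}\bigr)\qquad\text{for all } a\ge 1.$$ Put $\lambda_1=\varphi_1(1)$, $\lambda_2=\varphi_2(1)$, and let $\Psi(a)=\int_1^a\frac{\varphi_1(t)}2\,dt$ for $0\le a\le 1$, $\Psi(a)=\int_1^a\frac{\varphi_2(t)}2\,dt$ for $a>1$. Let $W^{1,s}_0(\Omega)$ be the set of $\psi\in W^{1,s}(\Omega)$ with $\int_\Omega\psi=0$ if $\Sigma_{\mathrm p}$ has zero $(d-1)$-dimensional measure, and with zero trace on $\Sigma_{\mathrm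 p}$ otherwise. Write $L^r(\Omega)$, $L^s(\Omega)$ for spaces of $\mathbb R^d$-valued fields, $\langle g,\varphi\rangle=\int_\Omega g\cdot\varphi$ for $g\in L^s(\Omega)$, $\varphi\in L^r(\Omega)$, and $$V=\{\varphi\in L^r(\Omega):\ \langle\nabla\psi,\varphi\rangle=0\ \text{ for all }\psi\in W^{1,s}_0(\Omega)\}.$$ Let $f_0\in L^s(\Omega)$, $\hat u\in L^r(\Omega)$, and $$\mathcal E(v)=\int_\Omega\Psi(|v+\hat u|^2)-\langle f_0,v+\hat u\rangle\qquad(v\in V).$$ A point $v\in V$ is a *local minimizer* of $\mathcal E$ if there is $\eta>0$ such that $\mathcal E(v+\delta\varphi)\ge\mathcal E(v)$ for all $\varphi\in V$ and $\delta\in[0,\eta)$. **Theorem 4.1 (existence and uniqueness when $\lambda_1\le\lambda_2$).** Suppose that $\lambda_1\le\lambda_2$. Then the integrals defining $\mathcal E(v)$ converge for every $v\in V$, and $\mathcal E$ has exactly one local minimizer $v$ in $V$; it is a global minimizer. Uniqueness holds even among those $v$ for which $\eta$ is allowed to depend on the direction $\varphi$. Moreover: 1. $v$ solves the weak problem reduced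 to the velocity: there are $h\in L^s(\Omega)$ and $\Lambda_v\in L^s(\Omega)$ such that a.e., with $u=v+\hat u$, $\Lambda_v=\varphi_1(|u|^2)u$ where $|u|<1$, $\Lambda_v=\varphi_2(|u|^2)u$ where $|u|>1$ and $\Lambda_v=h$ where $|u|=1$, and $\langle\Lambda_v,\varphi\rangle=\langle f_0,\varphi\rangle$ for all $\varphi\in V$. 2. Let $q\in L^r(\Omega)$ and $u_0\in L^r(\Sigma_{\mathrm v})$ be scalar functions. If $w=\hat u$ satisfies $\langle\nabla\psi,w\rangle=-\int_\Omega q\psi+\int_{\Sigma_{\mathrm v}}u_0\psi$ for all $\psi\in W^{1,s}_0(\Omega)$, then so does $w=v+\hat u$. -/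

import Mathlib

open MeasureTheory Set Filter Topology
open scoped ENNReal ContDiff

noncomputable section

namespace AdaptiveDarcy

/-- `ℝ^d` with its Euclidean norm. -/
abbrev Space (d : ℕ) : Type := EuclideanSpace ℝ (Fin d)

/-- The space `L^r(Ω)^d` of classes of vector fields. -/
abbrev VecLp {d : ℕ} (Ω : Set (Space d)) (r : ℝ) : Type :=
  Lp (Space d) (ENNReal.ofReal r) (volume.restrict Ω)

/-- The conjugate exponent `s = r / (r - 1)`. -/
def conjExp (r : ℝ) : ℝ := r / (r - 1)

/-! ### The domain and its boundary -/

/-- `Ω` has a Lipschitz boundary: near each boundary point, `Ω` is the open epigraph, in some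
direction `e`, of a Lipschitz function of the component orthogonal to `e`. -/
def HasLipschitzBoundary {d : ℕ} (Ω : Set (Space d)) : Prop :=
  ∀ x ∈ frontier Ω, ∃ (e : Space d) (ρ : ℝ) (K : NNReal) (γ : Space d → ℝ),
    ‖e‖ = 1 ∧ 0 < ρ ∧ LipschitzWith K γ ∧
      ∀ y ∈ Metric.ball x ρ, (y ∈ Ω ↔ γ (y - inner ℝ e y • e) < inner ℝ e y)

/-- `S` is a relatively open subset of `∂Ω`. -/
def IsRelOpenInBoundary {d : ℕ} (Ω S : Set (Space d)) : Prop :=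
  ∃ O : Set (Space d), IsOpen O ∧ S = O ∩ frontier Ω

/-- A fracture `Ω` with its velocity boundary `Sv` and its pressure boundary `Sp`. -/
structure IsFracture {d : ℕ} (Ω Sv Sp : Set (Space d)) : Prop where
  isOpen : IsOpen Ω
  isBounded : Bornology.IsBounded Ω
  isConnected : IsConnected Ω
  lipschitz : HasLipschitzBoundary Ω
  relOpen_v : IsRelOpenInBoundary Ω Sv
  relOpen_p : IsRelOpenInBoundary Ω Sp
  cover : frontier Ω = closure (Sv ∪ Sp)
  disj : Disjoint Sv Sp

/-- The `(d-1)`-dimensional surface measure on `ℝ^d`. -/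
def surface (d : ℕ) : Measure (Space d) := Measure.euclideanHausdorffMeasure (d - 1)

/-! ### Sobolev functions and traces -/

/-- `G` is the weak gradient of `ξ` in `Ω`. -/
def HasWeakGradient {d : ℕ} (Ω : Set (Space d)) (ξ : Space d → ℝ) (G : Space d → Space d) :
    Prop :=
  ∀ η : Space d → ℝ, ContDiff ℝ ∞ η → HasCompactSupport η → tsupport η ⊆ Ω →
    ∀ y : Space d, ∫ x in Ω, ξ x * fderiv ℝ η x y = -∫ x in Ω, inner ℝ (G x) y * η x

/-- `ξ ∈ W^{1,s}(Ω)`, with weak gradient `G`. -/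
structure IsSobolev {d : ℕ} (Ω : Set (Space d)) (s : ℝ) (ξ : Space d → ℝ)
    (G : Space d → Space d) : Prop where
  memLp : MemLp ξ (ENNReal.ofReal s) (volume.restrict Ω)
  memLp_grad : MemLp G (ENNReal.ofReal s) (volume.restrict Ω)
  weak : HasWeakGradient Ω ξ G

/-- `g` is the trace on `S ⊆ ∂Ω` of the Sobolev function `ξ` with weak gradient `G`: there are
smooth functions on `ℝ^d` that converge to `ξ` in `W^{1,s}(Ω)` and to `g` in `L^s(S)`. -/
def HasTrace {d : ℕ} (Ω S : Set (Space d)) (s : ℝ) (ξ : Space d → ℝ) (G : Space d → Space d)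
    (g : Space d → ℝ) : Prop :=
  MemLp g (ENNReal.ofReal s) ((surface d).restrict S) ∧
  ∃ ζ : ℕ → Space d → ℝ, (∀ n, ContDiff ℝ ∞ (ζ n)) ∧
    Tendsto (fun n => eLpNorm (fun x => ζ n x - ξ x) (ENNReal.ofReal s) (volume.restrict Ω))
      atTop (𝓝 0) ∧
    Tendsto (fun n => eLpNorm (fun x => gradient (ζ n) x - G x) (ENNReal.ofReal s)
      (volume.restrict Ω)) atTop (𝓝 0) ∧
    Tendsto (fun n => eLpNorm (fun x => ζ n x - g x) (ENNReal.ofReal s)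
      ((surface d).restrict S)) atTop (𝓝 0)

/-- `ψ ∈ W_0^{1,s}(Ω)`, with weak gradient `G`: zero mean if `Sp` has zero surface measure, and
zero trace on `Sp` otherwise. -/
structure MemW0 {d : ℕ} (Ω Sp : Set (Space d)) (s : ℝ) (ψ : Space d → ℝ)
    (G : Space d → Space d) : Prop where
  isSobolev : IsSobolev Ω s ψ G
  mean : surface d Sp = 0 → ∫ x in Ω, ψ x = 0
  trace : surface d Sp ≠ 0 → HasTrace Ω Sp s ψ G (fun _ => 0)

/-- The pairing `⟨g, φ⟩ = ∫_Ω g · φ`. -/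
def pairing {d : ℕ} (Ω : Set (Space d)) (g φ : Space d → Space d) : ℝ :=
  ∫ x in Ω, inner ℝ (g x) (φ x)

theorem integrable_inner_of_conj {d : ℕ} (Ω : Set (Space d)) {r : ℝ} (hr : 2 ≤ r)
    {g φ : Space d → Space d}
    (hg : MemLp g (ENNReal.ofReal (conjExp r)) (volume.restrict Ω))
    (hφ : MemLp φ (ENNReal.ofReal r) (volume.restrict Ω)) :
    Integrable (fun x => (inner ℝ (g x) (φ x) : ℝ)) (volume.restrict Ω) := by
  have h1 : r.HolderConjugate (conjExp r) := Real.HolderConjugate.conjExponent (by linarith)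
  have : ENNReal.HolderConjugate (ENNReal.ofReal (conjExp r)) (ENNReal.ofReal r) :=
    h1.symm.ennrealOfReal
  rw [← memLp_one_iff_integrable]
  refine MemLp.of_bilin (r := 1) (fun a b => (inner ℝ a b : ℝ)) 1 hg hφ
    (hg.1.inner hφ.1) (Eventually.of_forall fun x => ?_)
  have h := norm_inner_le_norm (𝕜 := ℝ) (g x) (φ x)
  rw [one_mul]
  exact_mod_cast h

/-- The space `V` of the fields of `L^r(Ω)` that are orthogonal to all the gradients of functions of
`W_0^{1,s}(Ω)`. -/
def V {d : ℕ} (Ω Sp : Set (Space d)) (r : ℝ) (hr : 2 ≤ r) : Submodule ℝ (VecLp Ω r) where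
  carrier := {φ | ∀ (ψ : Space d → ℝ) (G : Space d → Space d),
    MemW0 Ω Sp (conjExp r) ψ G → pairing Ω G φ = 0}
  zero_mem' := by
    intro ψ G _
    have h : pairing Ω G ((0 : VecLp Ω r) : Space d → Space d) = ∫ x in Ω, (0 : ℝ) := by
      refine integral_congr_ae ?_
      filter_upwards [Lp.coeFn_zero (Space d) (ENNReal.ofReal r) (volume.restrict Ω)] with x hx
      rw [hx, Pi.zero_apply, inner_zero_right]
    simpa using h
  add_mem' := by
    intro a b ha hb ψ G hψ
    have h : pairing Ω G ((a + b : VecLp Ω r) : Space d → Space d)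
        = ∫ x in Ω, ((inner ℝ (G x) (a x) : ℝ) + inner ℝ (G x) (b x)) := by
      refine integral_congr_ae ?_
      filter_upwards [Lp.coeFn_add a b] with x hx
      rw [hx, Pi.add_apply, inner_add_right]
    rw [h, integral_add
      (integrable_inner_of_conj Ω hr hψ.isSobolev.memLp_grad (Lp.memLp a))
      (integrable_inner_of_conj Ω hr hψ.isSobolev.memLp_grad (Lp.memLp b))]
    have h1 := ha ψ G hψ
    have h2 := hb ψ G hψ
    unfold pairing at h1 h2
    rw [h1, h2, add_zero]
  smul_mem' := by
    intro t a ha ψ G hψ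
    have h : pairing Ω G ((t • a : VecLp Ω r) : Space d → Space d)
        = ∫ x in Ω, t * (inner ℝ (G x) (a x) : ℝ) := by
      refine integral_congr_ae ?_
      filter_upwards [Lp.coeFn_smul t a] with x hx
      rw [hx, Pi.smul_apply, inner_smul_right]
    have h1 := ha ψ G hψ
    unfold pairing at h1
    rw [h, integral_const_mul, h1, mul_zero]

/-- The weak form of `div u = q` in `Ω`, `u · n = u₀` on `Sv`. -/
def HasFluxData {d : ℕ} (Ω Sv Sp : Set (Space d)) (r : ℝ) (q u₀ : Space d → ℝ)
    (u : VecLp Ω r) : Prop :=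
  ∀ (ψ : Space d → ℝ) (G : Space d → Space d) (g : Space d → ℝ),
    MemW0 Ω Sp (conjExp r) ψ G → HasTrace Ω Sv (conjExp r) ψ G g →
      pairing Ω G u = -(∫ x in Ω, q x * ψ x) + ∫ x in Sv, u₀ x * g x ∂(surface d)

/-! ### The laws, the energy, minimizers -/

/-- The assumptions on the low-speed law `φ₁` (used on `[0,1]`) and on the high-speed law `φ₂`
(used on `[1,∞)`). -/
structure AdmissibleLaws (r : ℝ) (φ₁ φ₂ : ℝ → ℝ) : Prop where
  nonneg₁ : ∀ a ∈ Icc (0 : ℝ) 1, 0 ≤ φ₁ a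
  pos₁ : ∀ a ∈ Ioo (0 : ℝ) 1, 0 < φ₁ a
  continuous₁ : ContinuousOn φ₁ (Icc 0 1)
  monotone₁ : MonotoneOn φ₁ (Icc 0 1)
  continuous₂ : ContinuousOn φ₂ (Ici 1)
  monotone₂ : MonotoneOn φ₂ (Ici 1)
  growth : ∃ c C : ℝ, 0 < c ∧ 0 < C ∧ ∀ a : ℝ, 1 ≤ a →
    c * a ^ ((r - 2) / 2) ≤ φ₂ a ∧ φ₂ a ≤ C * (1 + a ^ ((r - 2) / 2))

/-- The primitive of `φ / 2` that vanishes at `1`. -/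
def primitive (φ : ℝ → ℝ) (a : ℝ) : ℝ := ∫ t in (1 : ℝ)..a, φ t / 2

/-- The energy density `Ψ`. -/
def Psi (φ₁ φ₂ : ℝ → ℝ) (a : ℝ) : ℝ := if a ≤ 1 then primitive φ₁ a else primitive φ₂ a

/-- The dissipation `v ↦ ∫_Ω Ψ(|v + û|²)`. -/
def dissipation {d : ℕ} {Ω : Set (Space d)} {r : ℝ} {W : Submodule ℝ (VecLp Ω r)}
    (φ₁ φ₂ : ℝ → ℝ) (uhat : VecLp Ω r) (v : W) : ℝ :=
  ∫ x in Ω, Psi φ₁ φ₂ (‖((v : VecLp Ω r) + uhat) x‖ ^ 2)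

/-- The energy `v ↦ ∫_Ω Ψ(|v + û|²) - ⟨f₀, v + û⟩`. -/
def energy {d : ℕ} {Ω : Set (Space d)} {r : ℝ} {W : Submodule ℝ (VecLp Ω r)}
    (φ₁ φ₂ : ℝ → ℝ) (f₀ : VecLp Ω (conjExp r)) (uhat : VecLp Ω r) (v : W) : ℝ :=
  dissipation φ₁ φ₂ uhat v - pairing Ω f₀ ((v : VecLp Ω r) + uhat : VecLp Ω r)

/-- Strong local minimizers: one `η` serves all directions `φ`. -/
def IsStrongLocalMinimizer {W : Type*} [AddCommGroup W] [Module ℝ W] (F : W → ℝ) (v : W) : Prop :=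
  ∃ η : ℝ, 0 < η ∧ ∀ φ : W, ∀ δ ∈ Ico (0 : ℝ) η, F v ≤ F (v + δ • φ)

/-- Directional local minimizers: `η` may depend on the direction. Global minimizers, local
minimizers for a vector space topology and strong local minimizers are all of this kind. -/
def IsDirectionalLocalMinimizer {W : Type*} [AddCommGroup W] [Module ℝ W] (F : W → ℝ) (v : W) :
    Prop :=
  ∀ φ : W, ∃ η : ℝ, 0 < η ∧ ∀ δ ∈ Ico (0 : ℝ) η, F v ≤ F (v + δ • φ)

/-! ### The multi-valued law -/

/-- The field `φ₁(|u|²) u` where `|u| < 1`, `φ₂(|u|²) u` where `|u| > 1`, and `0` where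
`|u| = 1`. -/
def bulkLaw {d : ℕ} (φ₁ φ₂ : ℝ → ℝ) (u : Space d → Space d) (x : Space d) : Space d :=
  {y | ‖u y‖ < 1}.indicator (fun y => φ₁ (‖u y‖ ^ 2) • u y) x +
    {y | 1 < ‖u y‖}.indicator (fun y => φ₂ (‖u y‖ ^ 2) • u y) x

/-- The multi-valued law `Λ(u) ⊆ L^s(Ω)`: arbitrary on the interface `|u| = 1`. -/
def combinedLaw {d : ℕ} {Ω : Set (Space d)} {r : ℝ} (φ₁ φ₂ : ℝ → ℝ) (u : VecLp Ω r) :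
    Set (VecLp Ω (conjExp r)) :=
  {g | ∃ h : VecLp Ω (conjExp r), ∀ᵐ x ∂(volume.restrict Ω),
    g x = bulkLaw φ₁ φ₂ u x + {y | ‖u y‖ = 1}.indicator (fun y => h y) x}

/-- `v` solves the weak problem reduced to the velocity: some selection `Λ_v ∈ Λ(v + û)` satisfies
`⟨Λ_v, φ⟩ = ⟨f₀, φ⟩` for all `φ ∈ W`. -/
def SolvesReducedProblem {d : ℕ} {Ω : Set (Space d)} {r : ℝ} {W : Submodule ℝ (VecLp Ω r)}
    (φ₁ φ₂ : ℝ → ℝ) (f₀ : VecLp Ω (conjExp r)) (uhat : VecLp Ω r) (v : W) : Prop :=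
  ∃ g ∈ combinedLaw φ₁ φ₂ ((v : VecLp Ω r) + uhat),
    ∀ φ : W, pairing Ω g (φ : VecLp Ω r) = pairing Ω f₀ (φ : VecLp Ω r)

end AdaptiveDarcy

end

/-
Since `λ₁ ≤ λ₂`, the two laws join into one monotone, possibly discontinuous factor `g`, and `Ψ` is
its primitive. By superadditivity of `Ψ - Ψ(0)` and the parallelogram law, the energy is uniformly
convex at midpoints: a minimizing sequence is Cauchy, and minimizers are unique. Subgradients make
the energy convex and lower semicontinuous, so the limit minimizes and directional local minimizers
are global.

At a minimizer `u`, one-sided derivatives give the Euler-Lagrange equation up to an error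
`O(∫_A |φ|)` from the interface `A = {|u| = 1}`, where `g` jumps. The defect of the equation is thus
a functional of `φ` that factors boundedly through `L²(A)`, and the Riesz representation of this
functional is the multiplier on `A`.
-/

namespace AdaptiveDarcy

section ConvexMinimization

variable {X Y : Type*} [NormedAddCommGroup X] [NormedSpace ℝ X] [NormedAddCommGroup Y]
  [NormedSpace ℝ Y] {F : X → ℝ}

/-- Uniform convexity at midpoints: the convexity gap at the midpoint of two points is bounded
below in terms of their distance only. -/
def UniformlyMidpointConvex (F : X → ℝ) : Prop :=
  ∀ ρ : ℝ, 0 < ρ → ∃ δ : ℝ, 0 < δ ∧ ∀ u w : X, ρ ≤ ‖u - w‖ →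
    F (midpoint ℝ u w) + δ ≤ (F u + F w) / 2

namespace UniformlyMidpointConvex

theorem comp_affineIsometry (hF : UniformlyMidpointConvex F) (f : Y →ᵃⁱ[ℝ] X) :
    UniformlyMidpointConvex (F ∘ f) := by
  intro ρ hρ
  obtain ⟨δ, hδ, h⟩ := hF ρ hρ
  refine ⟨δ, hδ, fun u w huw => ?_⟩
  have hmid : f (midpoint ℝ u w) = midpoint ℝ (f u) (f w) := f.toAffineMap.map_midpoint u w
  rw [Function.comp_apply, hmid]
  exact h _ _ (by rwa [← dist_eq_norm, f.dist_map, dist_eq_norm])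

theorem eq_of_forall_le (hF : UniformlyMidpointConvex F) {u w : X} (hu : ∀ x, F u ≤ F x)
    (hw : ∀ x, F w ≤ F x) : u = w := by
  by_contra hne
  obtain ⟨δ, hδ, h⟩ := hF ‖u - w‖ (norm_pos_iff.2 (sub_ne_zero.2 hne))
  linarith [h u w le_rfl, hu (midpoint ℝ u w), hw (midpoint ℝ u w)]

theorem cauchySeq_of_tendsto (hF : UniformlyMidpointConvex F) {m : ℝ} (hm : ∀ x, m ≤ F x)
    {u : ℕ → X} (hu : Tendsto (fun n => F (u n)) atTop (𝓝 m)) : CauchySeq u := by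
  refine Metric.cauchySeq_iff.2 fun ρ hρ => ?_
  obtain ⟨δ, hδ, h⟩ := hF ρ hρ
  obtain ⟨N, hN⟩ := eventually_atTop.1 (hu.eventually_lt_const (lt_add_of_pos_right m hδ))
  refine ⟨N, fun k hk l hl => ?_⟩
  by_contra! hkl
  rw [dist_eq_norm] at hkl
  linarith [h _ _ hkl, hm (midpoint ℝ (u k) (u l)), hN k hk, hN l hl]

theorem exists_forall_le [CompleteSpace X] (hF : UniformlyMidpointConvex F)
    (hlsc : LowerSemicontinuous F) (hbdd : BddBelow (range F)) : ∃ v, ∀ w, F v ≤ F w := by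
  have hm : ∀ w, sInf (range F) ≤ F w := fun w => csInf_le hbdd (mem_range_self w)
  obtain ⟨_, -, hlim, hmem⟩ := exists_seq_tendsto_sInf (range_nonempty F) hbdd
  choose u hu using hmem
  simp only [← funext hu] at hlim
  obtain ⟨v, hv⟩ := cauchySeq_tendsto_of_complete (hF.cauchySeq_of_tendsto hm hlim)
  refine ⟨v, fun w => le_trans ?_ (hm w)⟩
  refine le_of_forall_lt_imp_le_of_dense fun y hy => ?_
  exact ge_of_tendsto hlim ((hv.eventually (hlsc v y hy)).mono fun _ => le_of_lt)

end UniformlyMidpointConvex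

theorem convexOn_of_forall_exists_subgradient
    (hF : ∀ u, ∃ L : X →L[ℝ] ℝ, ∀ w, F u + L (w - u) ≤ F w) : ConvexOn ℝ univ F := by
  refine ⟨convex_univ, fun u _ w _ a b ha hb hab => ?_⟩
  obtain ⟨L, hL⟩ := hF (a • u + b • w)
  have hcancel : a * L (u - (a • u + b • w)) + b * L (w - (a • u + b • w)) = 0 := by
    simp only [map_sub, map_add, map_smul, smul_eq_mul]
    linear_combination (-a * L u - b * L w) * hab
  have hu := mul_le_mul_of_nonneg_left (hL u) ha
  have hw := mul_le_mul_of_nonneg_left (hL w) hb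
  simp only [smul_eq_mul]
  linear_combination hu + hw - hcancel - F (a • u + b • w) * hab

theorem lowerSemicontinuous_of_forall_exists_subgradient
    (hF : ∀ u, ∃ L : X →L[ℝ] ℝ, ∀ w, F u + L (w - u) ≤ F w) : LowerSemicontinuous F := by
  intro u y hy
  obtain ⟨L, hL⟩ := hF u
  have hlim : Tendsto (fun w => F u + L (w - u)) (𝓝 u) (𝓝 (F u)) :=
    Continuous.tendsto' (by fun_prop) _ _ (by simp)
  exact (hlim.eventually_const_lt hy).mono fun w hw => hw.trans_le (hL w)

theorem IsStrongLocalMinimizer.isDirectionalLocalMinimizer {v : X}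
    (hv : IsStrongLocalMinimizer F v) : IsDirectionalLocalMinimizer F v := fun φ =>
  let ⟨η, hη, h⟩ := hv
  ⟨η, hη, h φ⟩

theorem IsDirectionalLocalMinimizer.forall_le_of_convexOn {v : X}
    (hv : IsDirectionalLocalMinimizer F v) (hF : ConvexOn ℝ univ F) (w : X) : F v ≤ F w := by
  obtain ⟨η, hη, h⟩ := hv (w - v)
  set δ := min (η / 2) 1
  have hδ : 0 < δ := by positivity
  have hmin := h δ ⟨hδ.le, (min_le_left _ _).trans_lt (half_lt_self hη)⟩
  have hconv := hF.2 (mem_univ v) (mem_univ w) (sub_nonneg.2 (min_le_right (η / 2) 1)) hδ.le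
    (sub_add_cancel 1 δ)
  rw [show (1 - δ) • v + δ • w = v + δ • (w - v) by module] at hconv
  simp only [smul_eq_mul] at hconv
  nlinarith

theorem exists_unique_localMinimizer [CompleteSpace X] (hmid : UniformlyMidpointConvex F)
    (hconv : ConvexOn ℝ univ F) (hlsc : LowerSemicontinuous F) (hbdd : BddBelow (range F)) :
    ∃ v, (∀ w, F v ≤ F w) ∧ {w | IsStrongLocalMinimizer F w} = {v} ∧
      ∀ w, IsDirectionalLocalMinimizer F w → w = v := by
  obtain ⟨v, hv⟩ := hmid.exists_forall_le hlsc hbdd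
  have huniq : ∀ w, IsDirectionalLocalMinimizer F w → w = v := fun w hw =>
    hmid.eq_of_forall_le (hw.forall_le_of_convexOn hconv) hv
  refine ⟨v, hv, Subset.antisymm (fun w hw => huniq w hw.isDirectionalLocalMinimizer) ?_, huniq⟩
  rintro w rfl
  exact ⟨1, one_pos, fun φ δ _ => hv _⟩

end ConvexMinimization

section MonotonePrimitive

variable {g : ℝ → ℝ} {E : Type*} [NormedAddCommGroup E] [InnerProductSpace ℝ E]

theorem intervalIntegrable_half_of_monotone (hg : Monotone g) (a b : ℝ) :
    IntervalIntegrable (fun t => g t / 2) volume a b :=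
  hg.intervalIntegrable.div_const 2

theorem primitive_sub_primitive (hg : Monotone g) (a b : ℝ) :
    primitive g b - primitive g a = ∫ t in a..b, g t / 2 :=
  intervalIntegral.integral_interval_sub_left (intervalIntegrable_half_of_monotone hg _ _)
    (intervalIntegrable_half_of_monotone hg _ _)

theorem continuous_primitive (hg : Monotone g) : Continuous (primitive g) :=
  intervalIntegral.continuous_primitive (intervalIntegrable_half_of_monotone hg) 1

theorem mul_sub_le_primitive_sub (hg : Monotone g) (a b : ℝ) :
    g a / 2 * (b - a) ≤ primitive g b - primitive g a := by
  have hconst : ∀ x y : ℝ, ∫ _ in x..y, g a / 2 = g a / 2 * (y - x) := fun x y => by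
    rw [intervalIntegral.integral_const, smul_eq_mul, mul_comm]
  rcases le_total a b with hab | hab
  · rw [primitive_sub_primitive hg, ← hconst]
    exact intervalIntegral.integral_mono_on hab intervalIntegrable_const
      (intervalIntegrable_half_of_monotone hg _ _) fun t ht => by linarith [hg ht.1]
  · have h : primitive g a - primitive g b ≤ g a / 2 * (a - b) := by
      rw [primitive_sub_primitive hg, ← hconst]
      exact intervalIntegral.integral_mono_on hab (intervalIntegrable_half_of_monotone hg _ _)
        intervalIntegrable_const fun t ht => by linarith [hg ht.2]
    linarith

theorem monotone_primitive (hg : Monotone g) (hg0 : ∀ a, 0 ≤ g a) : Monotone (primitive g) := by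
  intro a b hab
  nlinarith [mul_sub_le_primitive_sub hg a b, hg0 a]

theorem primitive_add_primitive_le (hg : Monotone g) {a b : ℝ} (ha : 0 ≤ a) (hb : 0 ≤ b) :
    primitive g a + primitive g b ≤ primitive g (a + b) + primitive g 0 := by
  have hshift : Monotone fun t => g (a + t) := fun x y hxy => hg (by linarith)
  have h : ∫ t in (0 : ℝ)..b, g t / 2 ≤ ∫ t in (0 : ℝ)..b, g (a + t) / 2 :=
    intervalIntegral.integral_mono_on hb (intervalIntegrable_half_of_monotone hg _ _)
      (intervalIntegrable_half_of_monotone hshift _ _) fun t _ => by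
        linarith [hg (le_add_of_nonneg_left ha : t ≤ a + t)]
  rw [intervalIntegral.integral_comp_add_left (fun t => g t / 2), add_zero,
    ← primitive_sub_primitive hg, ← primitive_sub_primitive hg] at h
  linarith

-- The parallelogram law splits `(‖z‖² + ‖w‖²) / 2`, at which superadditivity applies.
theorem primitive_norm_sq_midpoint_le (hg : Monotone g) (z w : E) :
    primitive g (‖midpoint ℝ z w‖ ^ 2)
        + (primitive g (‖(2 : ℝ)⁻¹ • (z - w)‖ ^ 2) - primitive g 0)
      ≤ (primitive g (‖z‖ ^ 2) + primitive g (‖w‖ ^ 2)) / 2 := by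
  have hsplit : ‖midpoint ℝ z w‖ ^ 2 + ‖(2 : ℝ)⁻¹ • (z - w)‖ ^ 2 = (‖z‖ ^ 2 + ‖w‖ ^ 2) / 2 := by
    rw [midpoint_eq_smul_add, norm_smul, norm_smul, invOf_eq_inv]
    norm_num
    linarith [parallelogram_law_with_norm ℝ z w]
  have hsup := primitive_add_primitive_le hg (sq_nonneg ‖midpoint ℝ z w‖)
    (sq_nonneg ‖(2 : ℝ)⁻¹ • (z - w)‖)
  rw [hsplit] at hsup
  linarith [mul_sub_le_primitive_sub hg ((‖z‖ ^ 2 + ‖w‖ ^ 2) / 2) (‖z‖ ^ 2),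
    mul_sub_le_primitive_sub hg ((‖z‖ ^ 2 + ‖w‖ ^ 2) / 2) (‖w‖ ^ 2)]

theorem inner_le_primitive_norm_sq_sub (hg : Monotone g) (hg0 : ∀ a, 0 ≤ g a) (z w : E) :
    inner ℝ (g (‖z‖ ^ 2) • z) (w - z) ≤ primitive g (‖w‖ ^ 2) - primitive g (‖z‖ ^ 2) := by
  refine le_trans ?_ (mul_sub_le_primitive_sub hg _ _)
  have hexpand : ‖w‖ ^ 2 - ‖z‖ ^ 2 = 2 * inner ℝ z (w - z) + ‖w - z‖ ^ 2 := by
    have := norm_add_sq_real z (w - z)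
    rw [add_sub_cancel] at this
    linarith
  rw [hexpand, real_inner_smul_left]
  linarith [mul_nonneg (hg0 (‖z‖ ^ 2)) (sq_nonneg ‖w - z‖)]

end MonotonePrimitive

section PowerLaw

/-- A nonnegative nondecreasing factor `g` with `g(|u|²)` growing like `|u|^(r-2)`: the Darcy law
`u ↦ g(|u|²) u` then maps `L^r` to its dual. Jumps of `g` are allowed. -/
structure IsPowerLaw (r : ℝ) (g : ℝ → ℝ) : Prop where
  monotone : Monotone g
  nonneg : ∀ a, 0 ≤ g a
  pos : ∀ a, 0 < a → 0 < g a
  growth_le : ∃ K : ℝ, ∀ t : ℝ, 0 ≤ t → g (t ^ 2) ≤ K * (1 + t) ^ (r - 2)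
  le_growth : ∃ c : ℝ, 0 < c ∧ ∀ a : ℝ, 1 ≤ a → c * a ^ ((r - 2) / 2) ≤ g a

namespace IsPowerLaw

variable {r : ℝ} {g : ℝ → ℝ}

theorem norm_smul_le {E : Type*} [NormedAddCommGroup E] [NormedSpace ℝ E] {K : ℝ}
    (hg : IsPowerLaw r g) (hK : ∀ t : ℝ, 0 ≤ t → g (t ^ 2) ≤ K * (1 + t) ^ (r - 2)) (z : E) :
    ‖g (‖z‖ ^ 2) • z‖ ≤ K * (1 + ‖z‖) ^ (r - 1) := by
  rw [norm_smul, Real.norm_of_nonneg (hg.nonneg _)]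
  calc g (‖z‖ ^ 2) * ‖z‖ ≤ K * (1 + ‖z‖) ^ (r - 2) * (1 + ‖z‖) :=
        mul_le_mul (hK _ (norm_nonneg z)) (by linarith) (norm_nonneg z)
          ((hg.nonneg _).trans (hK _ (norm_nonneg z)))
    _ = K * (1 + ‖z‖) ^ (r - 1) := by
        rw [mul_assoc, ← Real.rpow_add_one (by positivity)]
        ring_nf

theorem primitive_zero_lt (hg : IsPowerLaw r g) {a : ℝ} (ha : 0 < a) :
    primitive g 0 < primitive g a := by
  have hhalf := mul_pos (hg.pos _ (half_pos ha)) ha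
  linarith [mul_sub_le_primitive_sub hg.monotone (a / 2) a,
    monotone_primitive hg.monotone hg.nonneg (half_pos ha).le]

theorem exists_mul_rpow_sub_one_le (hg : IsPowerLaw r g) (hr : 0 < r) :
    ∃ c : ℝ, 0 < c ∧ ∀ b : ℝ, 1 ≤ b →
      c * (b ^ (r / 2) - 1) ≤ primitive g b - primitive g 1 := by
  obtain ⟨c, hc, hgc⟩ := hg.le_growth
  refine ⟨c / r, by positivity, fun b hb => ?_⟩
  have hint : ∫ t in (1 : ℝ)..b, c / 2 * t ^ ((r - 2) / 2) = c / r * (b ^ (r / 2) - 1) := by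
    rw [intervalIntegral.integral_const_mul, integral_rpow (Or.inl (by linarith)),
      show (r - 2) / 2 + 1 = r / 2 by ring, Real.one_rpow]
    field_simp
  rw [← hint, primitive_sub_primitive hg.monotone]
  exact intervalIntegral.integral_mono_on hb
    ((intervalIntegral.intervalIntegrable_rpow' (by linarith)).const_mul _)
    (intervalIntegrable_half_of_monotone hg.monotone _ _) fun t ht => by linarith [hgc t ht.1]

theorem exists_mul_rpow_le (hg : IsPowerLaw r g) (hr : 0 < r) {η : ℝ} (hη : 0 < η) :
    ∃ c : ℝ, 0 < c ∧ ∀ b : ℝ, 0 ≤ b →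
      c * b ^ (r / 2) ≤ c * η + (primitive g b - primitive g 0) := by
  obtain ⟨c, hc, hlarge⟩ := hg.exists_mul_rpow_sub_one_le hr
  have hP := monotone_primitive hg.monotone hg.nonneg
  set ε : ℝ := min η 1 ^ (2 / r) with hε
  have hε0 : 0 < ε := by positivity
  have hε1 : ε ≤ 1 := Real.rpow_le_one (by positivity) (min_le_right _ _) (by positivity)
  have hεr : ε ^ (r / 2) ≤ η := by
    rw [hε, ← Real.rpow_mul (by positivity), show 2 / r * (r / 2) = 1 by field_simp,
      Real.rpow_one]
    exact min_le_left _ _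
  have hgap := sub_pos.2 (hg.primitive_zero_lt hε0)
  set k := min (primitive g ε - primitive g 0) c
  have hk : 0 < k := lt_min hgap hc
  refine ⟨k, hk, fun b hb => ?_⟩
  have hkε : k ≤ primitive g ε - primitive g 0 := min_le_left _ _
  have hkη : 0 ≤ k * η := by positivity
  rcases le_total b ε with hbε | hbε
  · have := (Real.rpow_le_rpow hb hbε (by positivity)).trans hεr
    linarith [hP hb, mul_le_mul_of_nonneg_left this hk.le]
  rcases le_total b 1 with hb1 | hb1
  · have := Real.rpow_le_one hb hb1 (by positivity : 0 ≤ r / 2)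
    linarith [hP hbε, mul_le_mul_of_nonneg_left this hk.le]
  · have hle := Real.one_le_rpow hb1 (by positivity : 0 ≤ r / 2)
    linarith [hP hε1, hlarge b hb1,
      mul_le_mul_of_nonneg_right (min_le_right _ _ : k ≤ c) (sub_nonneg.2 hle)]

end IsPowerLaw

end PowerLaw

section InnerPairing

variable {α E : Type*} [MeasurableSpace α] {μ : Measure α} [NormedAddCommGroup E]
  [InnerProductSpace ℝ E] {p q : ℝ≥0∞} [ENNReal.HolderConjugate q p]

theorem integrable_inner_of_memLp {f φ : α → E} (hf : MemLp f q μ) (hφ : MemLp φ p μ) :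
    Integrable (fun x => inner ℝ (f x) (φ x)) μ := by
  rw [← memLp_one_iff_integrable]
  exact MemLp.of_bilin (r := 1) (fun a b => inner ℝ a b) 1 hf hφ (hf.1.inner hφ.1)
    (Eventually.of_forall fun x => by rw [one_mul]; exact nnnorm_inner_le_nnnorm _ _)

theorem exists_clm_eq_integral_inner [Fact (1 ≤ p)] {f : α → E} (hf : MemLp f q μ) :
    ∃ L : Lp E p μ →L[ℝ] ℝ, ∀ φ : Lp E p μ, L φ = ∫ x, inner ℝ (f x) (φ x) ∂μ := by
  have : Fact (1 ≤ q) := ⟨ENNReal.HolderTriple.le q p 1⟩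
  refine ⟨(innerSL ℝ).lpPairing μ q p hf.toLp, fun φ => ?_⟩
  rw [ContinuousLinearMap.lpPairing_eq_integral]
  refine integral_congr_ae ?_
  filter_upwards [hf.coeFn_toLp] with x hx
  rw [hx]
  rfl

theorem norm_rpow_eq_integral {F : Type*} [NormedAddCommGroup F] {r : ℝ} (hr : 0 < r)
    (u : Lp F (ENNReal.ofReal r) μ) : ‖u‖ ^ r = ∫ x, ‖u x‖ ^ r ∂μ := by
  rw [Lp.norm_def, toReal_eLpNorm (Lp.aestronglyMeasurable u),
    lpNorm_eq_integral_norm_rpow_toReal (by simpa using hr) ENNReal.ofReal_ne_top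
      (Lp.aestronglyMeasurable u), ENNReal.toReal_ofReal hr.le,
    Real.rpow_inv_rpow (by positivity) hr.ne']

end InnerPairing

section Dissipation

variable {α E : Type*} [MeasurableSpace α] [NormedAddCommGroup E] {μ : Measure α} {r s : ℝ}
  {g : ℝ → ℝ}

/-- The total dissipation `∫ P(|u|²)` of a velocity field, `P` being the primitive of `g / 2`. -/
noncomputable def totalDissipation (g : ℝ → ℝ) (μ : Measure α) (u : α → E) : ℝ :=
  ∫ x, primitive g (‖u x‖ ^ 2) ∂μ

theorem totalDissipation_congr_ae {u w : α → E} (h : u =ᵐ[μ] w) :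
    totalDissipation g μ u = totalDissipation g μ w :=
  integral_congr_ae (h.fun_comp fun z => primitive g (‖z‖ ^ 2))

variable [IsFiniteMeasure μ]

theorem memLp_one_add_norm_rpow (hrs : r.HolderConjugate s) {u : α → E}
    (hu : MemLp u (ENNReal.ofReal r) μ) :
    MemLp (fun x => (1 + ‖u x‖) ^ (r - 1)) (ENNReal.ofReal s) μ := by
  have hpow := ((memLp_const (1 : ℝ)).add hu.norm).norm_rpow_div (ENNReal.ofReal (r - 1))
  rw [← ENNReal.ofReal_div_of_pos hrs.sub_one_pos, ENNReal.toReal_ofReal hrs.sub_one_pos.le,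
    ← hrs.conjugate_eq] at hpow
  refine hpow.ae_eq (Eventually.of_forall fun x => ?_)
  have hpos : 0 ≤ 1 + ‖u x‖ := by positivity
  simp only [Pi.add_apply, Real.norm_of_nonneg hpos]

variable [InnerProductSpace ℝ E]

/-- The Darcy law `u ↦ g(|u|²) u`, applied to a velocity field. -/
noncomputable def darcyField (g : ℝ → ℝ) (u : α → E) (x : α) : E := g (‖u x‖ ^ 2) • u x

namespace IsPowerLaw

theorem memLp_darcyField (hg : IsPowerLaw r g) (hrs : r.HolderConjugate s) {u : α → E}
    (hu : MemLp u (ENNReal.ofReal r) μ) : MemLp (darcyField g u) (ENNReal.ofReal s) μ := by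
  obtain ⟨K, hK⟩ := hg.growth_le
  refine ((memLp_one_add_norm_rpow hrs hu).const_mul K).mono' ?_
    (Eventually.of_forall fun x => hg.norm_smul_le hK (u x))
  exact ((hg.monotone.measurable.comp_aemeasurable
    (hu.1.norm.aemeasurable.pow_const 2)).aestronglyMeasurable).smul hu.1

theorem integrable_primitive (hg : IsPowerLaw r g) (hr : 1 < r) {u : α → E}
    (hu : MemLp u (ENNReal.ofReal r) μ) : Integrable (fun x => primitive g (‖u x‖ ^ 2)) μ := by
  have hrs := Real.HolderConjugate.conjExponent hr
  have := hrs.symm.ennrealOfReal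
  refine ((integrable_const |primitive g 0|).add
    (integrable_inner_of_memLp (hg.memLp_darcyField hrs hu) hu)).mono'
    ((continuous_primitive hg.monotone).comp_aestronglyMeasurable (hu.1.norm.pow 2))
    (Eventually.of_forall fun x => ?_)
  have hlow := monotone_primitive hg.monotone hg.nonneg (sq_nonneg ‖u x‖)
  have hup := mul_sub_le_primitive_sub hg.monotone (‖u x‖ ^ 2) 0
  have hnn := mul_nonneg (hg.nonneg (‖u x‖ ^ 2)) (sq_nonneg ‖u x‖)
  rw [Pi.add_apply, darcyField, real_inner_smul_left, real_inner_self_eq_norm_sq,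
    Real.norm_eq_abs, abs_le]
  constructor <;> linarith [neg_abs_le (primitive g 0), le_abs_self (primitive g 0)]

theorem integrable_primitive_sub (hg : IsPowerLaw r g) (hr : 1 < r) {u w : α → E}
    (hu : MemLp u (ENNReal.ofReal r) μ) (hw : MemLp w (ENNReal.ofReal r) μ) :
    Integrable (fun x => primitive g (‖w x‖ ^ 2) - primitive g (‖u x‖ ^ 2)) μ :=
  (hg.integrable_primitive hr hw).sub (hg.integrable_primitive hr hu)

theorem totalDissipation_sub (hg : IsPowerLaw r g) (hr : 1 < r) {u w : α → E}
    (hu : MemLp u (ENNReal.ofReal r) μ) (hw : MemLp w (ENNReal.ofReal r) μ) :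
    totalDissipation g μ w - totalDissipation g μ u
      = ∫ x, (primitive g (‖w x‖ ^ 2) - primitive g (‖u x‖ ^ 2)) ∂μ :=
  (integral_sub (hg.integrable_primitive hr hw) (hg.integrable_primitive hr hu)).symm

theorem integral_inner_le_totalDissipation_sub (hg : IsPowerLaw r g) (hr : 1 < r) {u w : α → E}
    (hu : MemLp u (ENNReal.ofReal r) μ) (hw : MemLp w (ENNReal.ofReal r) μ) :
    ∫ x, inner ℝ (darcyField g u x) (w x - u x) ∂μ
      ≤ totalDissipation g μ w - totalDissipation g μ u := by
  have hrs := Real.HolderConjugate.conjExponent hr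
  have := hrs.symm.ennrealOfReal
  rw [hg.totalDissipation_sub hr hu hw]
  exact integral_mono (integrable_inner_of_memLp (hg.memLp_darcyField hrs hu) (hw.sub hu))
    (hg.integrable_primitive_sub hr hu hw)
    fun x => inner_le_primitive_norm_sq_sub hg.monotone hg.nonneg _ _

theorem integrable_primitive_sub_zero (hg : IsPowerLaw r g) (hr : 1 < r) {u : α → E}
    (hu : MemLp u (ENNReal.ofReal r) μ) :
    Integrable (fun x => primitive g (‖u x‖ ^ 2) - primitive g 0) μ :=
  (hg.integrable_primitive hr hu).sub (integrable_const _)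

theorem totalDissipation_sub_zero (hg : IsPowerLaw r g) (hr : 1 < r) {u : α → E}
    (hu : MemLp u (ENNReal.ofReal r) μ) :
    totalDissipation g μ u - totalDissipation g μ (0 : α → E)
      = ∫ x, (primitive g (‖u x‖ ^ 2) - primitive g 0) ∂μ := by
  rw [integral_sub (hg.integrable_primitive hr hu) (integrable_const _)]
  simp [totalDissipation]

theorem totalDissipation_midpoint_le (hg : IsPowerLaw r g) (hr : 1 < r) {u w : α → E}
    (hu : MemLp u (ENNReal.ofReal r) μ) (hw : MemLp w (ENNReal.ofReal r) μ) :
    totalDissipation g μ (fun x => midpoint ℝ (u x) (w x))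
        + (totalDissipation g μ (fun x => (2 : ℝ)⁻¹ • (u x - w x))
          - totalDissipation g μ (0 : α → E))
      ≤ (totalDissipation g μ u + totalDissipation g μ w) / 2 := by
  have hmid : MemLp (fun x => midpoint ℝ (u x) (w x)) (ENNReal.ofReal r) μ := by
    simp only [midpoint_eq_smul_add]
    exact (hu.add hw).const_smul (⅟ 2 : ℝ)
  have hdiff : MemLp (fun x => (2 : ℝ)⁻¹ • (u x - w x)) (ENNReal.ofReal r) μ :=
    (hu.sub hw).const_smul _
  have hPmid := hg.integrable_primitive hr hmid
  have hgap := hg.integrable_primitive_sub_zero hr hdiff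
  have hPu := hg.integrable_primitive hr hu
  have hPw := hg.integrable_primitive hr hw
  rw [hg.totalDissipation_sub_zero hr hdiff, totalDissipation, totalDissipation, totalDissipation,
    ← integral_add hPmid hgap, ← integral_add hPu hPw, ← integral_div]
  exact integral_mono (hPmid.add hgap) ((hPu.add hPw).div_const 2)
    fun x => primitive_norm_sq_midpoint_le hg.monotone (u x) (w x)

theorem exists_mul_norm_rpow_le (hg : IsPowerLaw r g) (hr : 1 < r) {η : ℝ} (hη : 0 < η) :
    ∃ c : ℝ, 0 < c ∧ ∀ u : Lp E (ENNReal.ofReal r) μ, c * ‖u‖ ^ r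
      ≤ c * (η * μ.real univ) + (totalDissipation g μ u - totalDissipation g μ (0 : α → E)) := by
  obtain ⟨c, hc, hcoer⟩ := hg.exists_mul_rpow_le (one_pos.trans hr) hη
  refine ⟨c, hc, fun u => ?_⟩
  have hgap := hg.integrable_primitive_sub_zero hr (Lp.memLp u)
  have hnorm : Integrable (fun x => ‖u x‖ ^ r) μ := by
    simpa only [ENNReal.toReal_ofReal (one_pos.trans hr).le] using
      (Lp.memLp u).integrable_norm_rpow'
  have hpoint : ∀ x, c * ‖u x‖ ^ r ≤ c * η + (primitive g (‖u x‖ ^ 2) - primitive g 0) := by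
    intro x
    have hx := hcoer (‖u x‖ ^ 2) (sq_nonneg _)
    rwa [← Real.rpow_natCast, ← Real.rpow_mul (norm_nonneg _), Nat.cast_two,
      mul_div_cancel₀ r two_ne_zero, Real.rpow_two] at hx
  have hint := integral_mono (hnorm.const_mul c) ((integrable_const (c * η)).add hgap) hpoint
  rw [integral_const_mul] at hint
  simp only [Pi.add_apply] at hint
  rw [integral_add (integrable_const _) hgap, integral_const, smul_eq_mul,
    ← norm_rpow_eq_integral (one_pos.trans hr), ← hg.totalDissipation_sub_zero hr (Lp.memLp u)]
    at hint
  linarith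

theorem exists_pos_le_totalDissipation_sub (hg : IsPowerLaw r g) (hr : 1 < r) {ρ : ℝ}
    (hρ : 0 < ρ) :
    ∃ δ : ℝ, 0 < δ ∧ ∀ u : Lp E (ENNReal.ofReal r) μ, ρ ≤ ‖u‖ →
      δ ≤ totalDissipation g μ u - totalDissipation g μ (0 : α → E) := by
  have hM : 0 ≤ μ.real univ := measureReal_nonneg
  have hη : 0 < ρ ^ r / (2 * (μ.real univ + 1)) := by positivity
  obtain ⟨c, hc, hcoer⟩ := hg.exists_mul_norm_rpow_le (μ := μ) (E := E) hr hη
  refine ⟨c * (ρ ^ r / 2), by positivity, fun u hu => ?_⟩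
  have hηM : ρ ^ r / (2 * (μ.real univ + 1)) * μ.real univ ≤ ρ ^ r / 2 := by
    rw [div_mul_eq_mul_div, div_le_div_iff₀ (by positivity) two_pos]
    nlinarith [Real.rpow_pos_of_pos hρ r]
  have hρu : ρ ^ r ≤ ‖u‖ ^ r := Real.rpow_le_rpow hρ.le hu (one_pos.trans hr).le
  nlinarith [hcoer u, mul_le_mul_of_nonneg_left hηM hc.le, mul_le_mul_of_nonneg_left hρu hc.le]

end IsPowerLaw

end Dissipation

section TotalEnergy

variable {α E : Type*} [MeasurableSpace α] [NormedAddCommGroup E] [InnerProductSpace ℝ E]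
  {μ : Measure α} {r : ℝ} {g : ℝ → ℝ}

/-- The energy of a velocity field: its dissipation minus the work `L u` of the forces. -/
noncomputable def totalEnergy [Fact (1 ≤ ENNReal.ofReal r)] (g : ℝ → ℝ)
    (L : Lp E (ENNReal.ofReal r) μ →L[ℝ] ℝ) (u : Lp E (ENNReal.ofReal r) μ) : ℝ :=
  totalDissipation g μ u - L u

theorem exists_le_mul_rpow_sub_mul {c ℓ : ℝ} (hr : 1 < r) (hc : 0 < c) (hℓ : 0 ≤ ℓ) :
    ∃ m : ℝ, ∀ t : ℝ, 0 ≤ t → m ≤ c * t ^ r - ℓ * t := by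
  set T := (ℓ / c) ^ (r - 1)⁻¹
  have hT : c * T ^ (r - 1) = ℓ := by
    rw [Real.rpow_inv_rpow (by positivity) (by linarith), mul_div_cancel₀ ℓ hc.ne']
  have hT0 : 0 ≤ T := by positivity
  refine ⟨-(ℓ * T), fun t ht => ?_⟩
  rcases le_total t T with htT | hTt
  · nlinarith [mul_nonneg hc.le (Real.rpow_nonneg ht r)]
  · have hsplit : t ^ r = t ^ (r - 1) * t := by
      rw [← Real.rpow_add_one' ht (by linarith), sub_add_cancel]
    have hgrow : ℓ ≤ c * t ^ (r - 1) :=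
      hT ▸ mul_le_mul_of_nonneg_left (Real.rpow_le_rpow hT0 hTt (by linarith)) hc.le
    rw [hsplit]
    nlinarith

variable [IsFiniteMeasure μ] [Fact (1 ≤ ENNReal.ofReal r)]

namespace IsPowerLaw

theorem uniformlyMidpointConvex_totalEnergy (hg : IsPowerLaw r g) (hr : 1 < r)
    (L : Lp E (ENNReal.ofReal r) μ →L[ℝ] ℝ) : UniformlyMidpointConvex (totalEnergy g L) := by
  intro ρ hρ
  obtain ⟨δ, hδ, hgap⟩ := hg.exists_pos_le_totalDissipation_sub (μ := μ) (E := E) hr (half_pos hρ)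
  refine ⟨δ, hδ, fun u w huw => ?_⟩
  have hhalf : ((2 : ℝ)⁻¹ • (u - w) : Lp E (ENNReal.ofReal r) μ)
      =ᵐ[μ] fun x => (2 : ℝ)⁻¹ • (u x - w x) := by
    filter_upwards [Lp.coeFn_smul (2 : ℝ)⁻¹ (u - w), Lp.coeFn_sub u w] with x hx hx'
    rw [hx, Pi.smul_apply, hx', Pi.sub_apply]
  have hmid : (midpoint ℝ u w : Lp E (ENNReal.ofReal r) μ) =ᵐ[μ]
      fun x => midpoint ℝ (u x) (w x) := by
    simp only [midpoint_eq_smul_add]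
    filter_upwards [Lp.coeFn_smul (⅟2 : ℝ) (u + w), Lp.coeFn_add u w] with x hx hx'
    rw [hx, Pi.smul_apply, hx', Pi.add_apply]
  have hρ' : ρ / 2 ≤ ‖(2 : ℝ)⁻¹ • (u - w)‖ := by
    rw [norm_smul, Real.norm_of_nonneg (by norm_num)]
    linarith
  have hL : L (midpoint ℝ u w) = (L u + L w) / 2 := by
    rw [midpoint_eq_smul_add, map_smul, map_add, invOf_eq_inv, smul_eq_mul]
    ring
  have hdiss := hg.totalDissipation_midpoint_le hr (Lp.memLp u) (Lp.memLp w)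
  rw [← totalDissipation_congr_ae hmid, ← totalDissipation_congr_ae hhalf] at hdiss
  unfold totalEnergy
  linarith [hgap _ hρ']

theorem exists_subgradient_totalEnergy (hg : IsPowerLaw r g) (hr : 1 < r)
    (L : Lp E (ENNReal.ofReal r) μ →L[ℝ] ℝ) (u : Lp E (ENNReal.ofReal r) μ) :
    ∃ L' : Lp E (ENNReal.ofReal r) μ →L[ℝ] ℝ,
      ∀ w, totalEnergy g L u + L' (w - u) ≤ totalEnergy g L w := by
  have hrs := Real.HolderConjugate.conjExponent hr
  have := hrs.symm.ennrealOfReal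
  obtain ⟨A, hA⟩ := exists_clm_eq_integral_inner (p := ENNReal.ofReal r)
    (hg.memLp_darcyField hrs (Lp.memLp u))
  refine ⟨A - L, fun w => ?_⟩
  have hAw : A (w - u) = ∫ x, inner ℝ (darcyField g u x) (w x - u x) ∂μ := by
    rw [hA]
    refine integral_congr_ae ?_
    filter_upwards [Lp.coeFn_sub w u] with x hx
    rw [hx, Pi.sub_apply]
  have hsub := hg.integral_inner_le_totalDissipation_sub hr (Lp.memLp u) (Lp.memLp w)
  rw [← hAw] at hsub
  rw [totalEnergy, totalEnergy, sub_apply, map_sub L]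
  linarith

theorem bddBelow_range_totalEnergy (hg : IsPowerLaw r g) (hr : 1 < r)
    (L : Lp E (ENNReal.ofReal r) μ →L[ℝ] ℝ) : BddBelow (range (totalEnergy g L)) := by
  obtain ⟨c, hc, hcoer⟩ := hg.exists_mul_norm_rpow_le (μ := μ) (E := E) hr one_pos
  obtain ⟨m, hm⟩ := exists_le_mul_rpow_sub_mul hr hc (norm_nonneg L)
  refine ⟨m - c * (1 * μ.real univ) + totalDissipation g μ (0 : α → E), ?_⟩
  rintro _ ⟨u, rfl⟩
  unfold totalEnergy
  linarith [hcoer u, hm ‖u‖ (norm_nonneg u), (le_abs_self (L u)).trans (L.le_opNorm u)]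

theorem exists_unique_localMinimizer_totalEnergy (hg : IsPowerLaw r g) (hr : 1 < r)
    [CompleteSpace E] (L : Lp E (ENNReal.ofReal r) μ →L[ℝ] ℝ)
    {W : Submodule ℝ (Lp E (ENNReal.ofReal r) μ)}
    (hW : IsClosed (W : Set (Lp E (ENNReal.ofReal r) μ))) (uhat : Lp E (ENNReal.ofReal r) μ) :
    ∃ v : W, (∀ w : W, totalEnergy g L (v + uhat) ≤ totalEnergy g L (w + uhat)) ∧
      {w : W | IsStrongLocalMinimizer (fun w : W => totalEnergy g L (w + uhat)) w} = {v} ∧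
      ∀ w : W, IsDirectionalLocalMinimizer (fun w : W => totalEnergy g L (w + uhat)) w →
        w = v := by
  have := hW.completeSpace_coe
  have hsub := hg.exists_subgradient_totalEnergy hr L
  let shift : W →ᵃⁱ[ℝ] Lp E (ENNReal.ofReal r) μ :=
    (AffineIsometryEquiv.vaddConst ℝ uhat).toAffineIsometry.comp W.subtypeₗᵢ.toAffineIsometry
  exact exists_unique_localMinimizer
    ((hg.uniformlyMidpointConvex_totalEnergy hr L).comp_affineIsometry shift)
    ((convexOn_of_forall_exists_subgradient hsub).comp_affineMap shift.toAffineMap)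
    ((lowerSemicontinuous_of_forall_exists_subgradient hsub).comp shift.continuous)
    ((hg.bddBelow_range_totalEnergy hr L).mono (range_comp_subset_range shift (totalEnergy g L)))

end IsPowerLaw

end TotalEnergy

section HilbertFactorization

variable {X H : Type*} [AddCommGroup X] [Module ℝ X] [NormedAddCommGroup H]
  [InnerProductSpace ℝ H] [CompleteSpace H]

theorem exists_inner_eq_of_le (T : X →ₗ[ℝ] H) (ℓ : X →ₗ[ℝ] ℝ) {C : ℝ}
    (hℓ : ∀ x, ℓ x ≤ C * ‖T x‖) : ∃ k : H, ∀ x, ℓ x = inner ℝ k (T x) := by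
  have habs : ∀ x, |ℓ x| ≤ C * ‖T x‖ := fun x =>
    abs_le'.2 ⟨hℓ x, by simpa only [map_neg, norm_neg] using hℓ (-x)⟩
  have hker : LinearMap.ker T ≤ LinearMap.ker ℓ := fun x hx => by
    have hx' := habs x
    rw [LinearMap.mem_ker.1 hx, norm_zero, mul_zero] at hx'
    exact abs_nonpos_iff.1 hx'
  let ℓ' : LinearMap.range T →ₗ[ℝ] ℝ :=
    ((LinearMap.ker T).liftQ ℓ hker).comp T.quotKerEquivRange.symm.toLinearMap
  have hℓ' : ∀ x, ℓ' ⟨T x, LinearMap.mem_range_self T x⟩ = ℓ x := fun x => by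
    have hx : T.quotKerEquivRange.symm ⟨T x, LinearMap.mem_range_self T x⟩
        = (LinearMap.ker T).mkQ x := (LinearEquiv.symm_apply_eq _).2 rfl
    simp only [ℓ', LinearMap.comp_apply, LinearEquiv.coe_coe, hx]
    rfl
  have hbound : ∀ y : LinearMap.range T, ‖ℓ' y‖ ≤ C * ‖y‖ := by
    rintro ⟨_, x, rfl⟩
    rw [hℓ' x]
    exact habs x
  obtain ⟨k, hk, -⟩ := exists_extension_norm_eq (LinearMap.range T) (ℓ'.mkContinuous C hbound)
  refine ⟨(InnerProductSpace.toDual ℝ H).symm k, fun x => ?_⟩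
  rw [InnerProductSpace.toDual_symm_apply, ← hℓ' x]
  exact (hk ⟨T x, LinearMap.mem_range_self T x⟩).symm

end HilbertFactorization

section RestrictL2

variable {α E : Type*} [MeasurableSpace α] [NormedAddCommGroup E] {μ : Measure α}
  [IsFiniteMeasure μ] {p : ℝ≥0∞}

theorem memLp_two_restrict (hp : 2 ≤ p) (A : Set α) (φ : Lp E p μ) : MemLp φ 2 (μ.restrict A) :=
  ((Lp.memLp φ).restrict A).mono_exponent hp

/-- The restriction to `A` of the fields in `L^p`, `p ≥ 2`, as a linear map into `L²(A)`. -/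
noncomputable def restrictL2 [NormedSpace ℝ E] (hp : 2 ≤ p) (A : Set α) :
    Lp E p μ →ₗ[ℝ] Lp E 2 (μ.restrict A) where
  toFun φ := (memLp_two_restrict hp A φ).toLp
  map_add' φ φ' := by
    rw [← MemLp.toLp_add]
    exact MemLp.toLp_congr _ _ (ae_restrict_of_ae (Lp.coeFn_add φ φ'))
  map_smul' c φ := by
    rw [RingHom.id_apply, ← MemLp.toLp_const_smul]
    exact MemLp.toLp_congr _ _ (ae_restrict_of_ae (Lp.coeFn_smul c φ))

theorem coeFn_restrictL2 [NormedSpace ℝ E] (hp : 2 ≤ p) (A : Set α) (φ : Lp E p μ) :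
    restrictL2 hp A φ =ᵐ[μ.restrict A] φ :=
  (memLp_two_restrict hp A φ).coeFn_toLp

theorem exists_integral_norm_le_mul_norm (E : Type*) [NormedAddCommGroup E] (μ : Measure α)
    [IsFiniteMeasure μ] : ∃ C : ℝ, ∀ f : Lp E 2 μ, ∫ x, ‖f x‖ ∂μ ≤ C * ‖f‖ := by
  set M := μ univ ^ (1 / (1 : ℝ≥0∞).toReal - 1 / (2 : ℝ≥0∞).toReal)
  have hM : M ≠ ⊤ := ENNReal.rpow_ne_top_of_nonneg (by norm_num) (measure_ne_top _ _)
  refine ⟨M.toReal, fun f => ?_⟩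
  have hle := eLpNorm_le_eLpNorm_mul_rpow_measure_univ one_le_two (Lp.aestronglyMeasurable f)
  have hle' := ENNReal.toReal_mono (ENNReal.mul_ne_top (Lp.eLpNorm_ne_top f) hM) hle
  rwa [ENNReal.toReal_mul, toReal_eLpNorm (Lp.aestronglyMeasurable f),
    lpNorm_one_eq_integral_norm (Lp.aestronglyMeasurable f), mul_comm] at hle'

end RestrictL2

section EulerLagrange

variable {α E : Type*} [MeasurableSpace α] [NormedAddCommGroup E] {μ : Measure α}
  [IsFiniteMeasure μ] {r s : ℝ} {g : ℝ → ℝ}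

theorem tendsto_integral_of_growth [NormedSpace ℝ E] (hrs : r.HolderConjugate s) {u φ : α → E}
    (hu : MemLp u (ENNReal.ofReal r) μ) (hφ : MemLp φ (ENNReal.ofReal r) μ) {G : E → E → ℝ}
    {K : ℝ} (hK : 0 ≤ K) (hG : ∀ z y, |G z y| ≤ K * (1 + ‖z‖) ^ (r - 1) * ‖y‖)
    (hmeas : ∀ t : ℝ, AEStronglyMeasurable (fun x => G (u x + t • φ x) (φ x)) μ)
    (hcont : ∀ᵐ x ∂μ, ContinuousAt (fun z => G z (φ x)) (u x)) :
    Tendsto (fun t : ℝ => ∫ x, G (u x + t • φ x) (φ x) ∂μ) (𝓝 0)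
      (𝓝 (∫ x, G (u x) (φ x) ∂μ)) := by
  have := hrs.symm.ennrealOfReal
  have hdom : Integrable (fun x => K * (1 + ‖‖u x‖ + ‖φ x‖‖) ^ (r - 1) * ‖φ x‖) μ :=
    ((memLp_one_add_norm_rpow hrs (hu.norm.add hφ.norm)).const_mul K).integrable_mul hφ.norm
  refine tendsto_integral_filter_of_dominated_convergence _ (Eventually.of_forall hmeas) ?_ hdom ?_
  · filter_upwards [Icc_mem_nhds (show (-1 : ℝ) < 0 by simp) one_pos] with t ht
    refine Eventually.of_forall fun x => (hG _ _).trans ?_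
    have htφ : ‖t • φ x‖ ≤ ‖φ x‖ := by
      rw [norm_smul]
      exact mul_le_of_le_one_left (norm_nonneg _) (abs_le.2 ht)
    have hle : ‖u x + t • φ x‖ ≤ ‖‖u x‖ + ‖φ x‖‖ :=
      ((norm_add_le _ _).trans (add_le_add_right htφ _)).trans (le_abs_self _)
    have hr := hrs.sub_one_pos.le
    gcongr
  · filter_upwards [hcont] with x hx
    have hpath : Tendsto (fun t : ℝ => u x + t • φ x) (𝓝 0) (𝓝 (u x)) :=
      Continuous.tendsto' (by fun_prop) _ _ (by simp)
    exact hx.tendsto.comp hpath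

variable [InnerProductSpace ℝ E]

namespace IsPowerLaw

theorem tendsto_integral_inner_darcyField (hg : IsPowerLaw r g) (hrs : r.HolderConjugate s)
    {u φ : α → E} (hu : MemLp u (ENNReal.ofReal r) μ) (hφ : MemLp φ (ENNReal.ofReal r) μ)
    (hcont : ∀ᵐ x ∂μ, ContinuousAt g (‖u x‖ ^ 2)) :
    Tendsto (fun t : ℝ => ∫ x, inner ℝ (darcyField g (fun y => u y + t • φ y) x) (φ x) ∂μ) (𝓝 0)
      (𝓝 (∫ x, inner ℝ (darcyField g u x) (φ x) ∂μ)) := by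
  obtain ⟨K, hK⟩ := hg.growth_le
  have hK0 : 0 ≤ K := by simpa using (hg.nonneg _).trans (hK 0 le_rfl)
  refine tendsto_integral_of_growth (G := fun z y => inner ℝ (g (‖z‖ ^ 2) • z) y) hrs hu hφ hK0
    (fun z y => ?_) (fun t => ?_) ?_
  · exact (abs_real_inner_le_norm _ _).trans
      (mul_le_mul_of_nonneg_right (hg.norm_smul_le hK z) (norm_nonneg y))
  · exact (hg.memLp_darcyField hrs (hu.add (hφ.const_smul t))).1.inner hφ.1
  · filter_upwards [hcont] with x hx
    have hgx : ContinuousAt (fun z : E => g (‖z‖ ^ 2)) (u x) :=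
      ContinuousAt.comp (f := fun z : E => ‖z‖ ^ 2) hx (by fun_prop)
    fun_prop

theorem integral_inner_darcyField_le (hg : IsPowerLaw r g) (hrs : r.HolderConjugate s)
    {u φ : α → E} (hu : MemLp u (ENNReal.ofReal r) μ) (hφ : MemLp φ (ENNReal.ofReal r) μ) {K : ℝ}
    (hK : ∀ t : ℝ, 0 ≤ t → g (t ^ 2) ≤ K * (1 + t) ^ (r - 2)) :
    ∫ x, inner ℝ (darcyField g u x) (φ x) ∂μ ≤ ∫ x, K * (1 + ‖u x‖) ^ (r - 1) * ‖φ x‖ ∂μ := by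
  have := hrs.symm.ennrealOfReal
  refine integral_mono (integrable_inner_of_memLp (hg.memLp_darcyField hrs hu) hφ)
    (((memLp_one_add_norm_rpow hrs hu).const_mul K).integrable_mul hφ.norm) fun x => ?_
  exact (real_inner_le_norm _ _).trans
    (mul_le_mul_of_nonneg_right (hg.norm_smul_le hK (u x)) (norm_nonneg _))

variable [Fact (1 ≤ ENNReal.ofReal r)]

theorem le_integral_inner_darcyField_of_forall_le (hg : IsPowerLaw r g) (hr : 1 < r)
    {L : Lp E (ENNReal.ofReal r) μ →L[ℝ] ℝ} {u φ : Lp E (ENNReal.ofReal r) μ}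
    (hmin : ∀ t : ℝ, totalEnergy g L u ≤ totalEnergy g L (u + t • φ)) {t : ℝ} (ht : 0 < t) :
    L φ ≤ ∫ x, inner ℝ (darcyField g (fun y => u y + t • φ y) x) (φ x) ∂μ := by
  have hshift : (u + t • φ : Lp E (ENNReal.ofReal r) μ) =ᵐ[μ] fun x => u x + t • φ x := by
    filter_upwards [Lp.coeFn_add u (t • φ), Lp.coeFn_smul t φ] with x hx hx'
    rw [hx, Pi.add_apply, hx', Pi.smul_apply]
  have hu := Lp.memLp u
  have hw : MemLp (fun x => u x + t • φ x) (ENNReal.ofReal r) μ :=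
    hu.add ((Lp.memLp φ).const_smul t)
  have hslope := hg.integral_inner_le_totalDissipation_sub hr hw hu
  simp only [sub_add_cancel_left, inner_neg_right, inner_smul_right, integral_neg,
    integral_const_mul] at hslope
  have ht' := hmin t
  rw [totalEnergy, totalEnergy, totalDissipation_congr_ae hshift, map_add, map_smul,
    smul_eq_mul] at ht'
  exact le_of_mul_le_mul_left (by linarith) ht

theorem le_setIntegral_compl_add_setIntegral (hg : IsPowerLaw r g) (hr : 1 < r)
    {L : Lp E (ENNReal.ofReal r) μ →L[ℝ] ℝ} {u φ : Lp E (ENNReal.ofReal r) μ}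
    (hmin : ∀ t : ℝ, totalEnergy g L u ≤ totalEnergy g L (u + t • φ)) {A : Set α}
    (hA : MeasurableSet A) (hcont : ∀ x ∉ A, ContinuousAt g (‖u x‖ ^ 2)) {K : ℝ}
    (hK : ∀ t : ℝ, 0 ≤ t → g (t ^ 2) ≤ K * (1 + t) ^ (r - 2)) :
    L φ ≤ ∫ x in Aᶜ, inner ℝ (darcyField g u x) (φ x) ∂μ
      + ∫ x in A, K * (1 + ‖u x‖) ^ (r - 1) * ‖φ x‖ ∂μ := by
  have hrs := Real.HolderConjugate.conjExponent hr
  have := hrs.symm.ennrealOfReal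
  have hK0 : 0 ≤ K := by simpa using (hg.nonneg _).trans (hK 0 le_rfl)
  have hu := Lp.memLp u
  have hφ := Lp.memLp φ
  have hshift : ∀ t : ℝ, MemLp (fun x => u x + t • φ x) (ENNReal.ofReal r) μ := fun t =>
    hu.add (hφ.const_smul t)
  have hout := hg.tendsto_integral_inner_darcyField hrs (hu.restrict Aᶜ) (hφ.restrict Aᶜ)
    ((ae_restrict_iff' hA.compl).2 (Eventually.of_forall hcont))
  have hin := tendsto_integral_of_growth (G := fun z y => K * (1 + ‖z‖) ^ (r - 1) * ‖y‖) hrs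
    (hu.restrict A) (hφ.restrict A) hK0 (fun z y => (abs_of_nonneg (by positivity)).le)
    (fun t => (((memLp_one_add_norm_rpow hrs ((hshift t).restrict A)).1.const_mul K).mul
      (hφ.restrict A).1.norm))
    (Eventually.of_forall fun x => by fun_prop (disch := positivity))
  refine ge_of_tendsto ((hout.add hin).mono_left (nhdsWithin_le_nhds (s := Ioi 0))) ?_
  filter_upwards [self_mem_nhdsWithin] with t ht
  refine (hg.le_integral_inner_darcyField_of_forall_le hr hmin ht).trans ?_
  rw [← integral_add_compl hA
    (integrable_inner_of_memLp (hg.memLp_darcyField hrs (hshift t)) hφ), add_comm]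
  exact add_le_add_right (hg.integral_inner_darcyField_le hrs ((hshift t).restrict A)
    (hφ.restrict A) hK) _

theorem le_setIntegral_compl_add_mul_setIntegral_norm (hg : IsPowerLaw r g) (hr : 1 < r)
    {L : Lp E (ENNReal.ofReal r) μ →L[ℝ] ℝ} {u φ : Lp E (ENNReal.ofReal r) μ}
    (hmin : ∀ t : ℝ, totalEnergy g L u ≤ totalEnergy g L (u + t • φ)) {A : Set α}
    (hA : MeasurableSet A) (hcont : ∀ x ∉ A, ContinuousAt g (‖u x‖ ^ 2)) {K R : ℝ}
    (hK : ∀ t : ℝ, 0 ≤ t → g (t ^ 2) ≤ K * (1 + t) ^ (r - 2)) (hR : ∀ x ∈ A, ‖u x‖ ≤ R) :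
    L φ ≤ ∫ x in Aᶜ, inner ℝ (darcyField g u x) (φ x) ∂μ
      + K * (1 + R) ^ (r - 1) * ∫ x in A, ‖φ x‖ ∂μ := by
  have hrs := Real.HolderConjugate.conjExponent hr
  have := hrs.symm.ennrealOfReal
  have hK0 : 0 ≤ K := by simpa using (hg.nonneg _).trans (hK 0 le_rfl)
  have hr0 : 0 ≤ r - 1 := by linarith
  have hφ := Lp.memLp φ
  have hint : Integrable (fun x => K * (1 + ‖u x‖) ^ (r - 1) * ‖φ x‖) μ :=
    ((memLp_one_add_norm_rpow hrs (Lp.memLp u)).const_mul K).integrable_mul hφ.norm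
  refine (hg.le_setIntegral_compl_add_setIntegral hr hmin hA hcont hK).trans
    (add_le_add_right ?_ _)
  rw [← integral_const_mul]
  refine setIntegral_mono_on hint.integrableOn
    (((hφ.integrable Fact.out).norm.const_mul _).integrableOn) hA fun x hx => ?_
  have hRx := hR x hx
  gcongr

theorem exists_defect_representation [CompleteSpace E] (hg : IsPowerLaw r g) (hr : 2 ≤ r)
    {L : Lp E (ENNReal.ofReal r) μ →L[ℝ] ℝ} {W : Submodule ℝ (Lp E (ENNReal.ofReal r) μ)}
    {u : Lp E (ENNReal.ofReal r) μ} (hmin : ∀ φ ∈ W, totalEnergy g L u ≤ totalEnergy g L (u + φ))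
    {A : Set α} (hA : MeasurableSet A) {R : ℝ} (hR : ∀ x ∈ A, ‖u x‖ ≤ R)
    (hcont : ∀ x ∉ A, ContinuousAt g (‖u x‖ ^ 2)) :
    ∃ k : Lp E 2 (μ.restrict A), ∀ φ ∈ W, L φ
      = ∫ x in Aᶜ, inner ℝ (darcyField g u x) (φ x) ∂μ + ∫ x in A, inner ℝ (k x) (φ x) ∂μ := by
  have hr1 : 1 < r := by linarith
  have hrs := Real.HolderConjugate.conjExponent hr1
  have := hrs.symm.ennrealOfReal
  have hr2 : 2 ≤ ENNReal.ofReal r := by simpa using ENNReal.ofReal_le_ofReal hr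
  obtain ⟨K, hK⟩ := hg.growth_le
  have hdarcy : MemLp (Aᶜ.indicator (darcyField g u)) (ENNReal.ofReal r.conjExponent) μ :=
    (hg.memLp_darcyField hrs (Lp.memLp u)).indicator hA.compl
  obtain ⟨B, hB⟩ := exists_clm_eq_integral_inner (p := ENNReal.ofReal r) hdarcy
  obtain ⟨C, hC⟩ := exists_integral_norm_le_mul_norm E (μ.restrict A)
  have hB' : ∀ φ, B φ = ∫ x in Aᶜ, inner ℝ (darcyField g u x) (φ x) ∂μ := fun φ => by
    rw [hB, ← integral_indicator hA.compl]
    refine integral_congr_ae (Eventually.of_forall fun x => ?_)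
    by_cases hx : x ∈ A <;> simp [hx]
  have hbound : ∀ φ ∈ W,
      (L - B) φ ≤ |K * (1 + R) ^ (r - 1)| * C * ‖restrictL2 hr2 A φ‖ := fun φ hφ => by
    have hle := hg.le_setIntegral_compl_add_mul_setIntegral_norm hr1
      (fun t => hmin _ (W.smul_mem t hφ)) hA hcont hK hR
    have hnorm : ∫ x in A, ‖φ x‖ ∂μ = ∫ x in A, ‖restrictL2 hr2 A φ x‖ ∂μ :=
      integral_congr_ae ((coeFn_restrictL2 hr2 A φ).fun_comp norm).symm
    rw [← hB', ← sub_le_iff_le_add'] at hle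
    rw [mul_assoc]
    exact hle.trans (mul_le_mul (le_abs_self _) (hnorm.trans_le (hC _))
      (integral_nonneg fun _ => norm_nonneg _) (abs_nonneg _))
  obtain ⟨k, hk⟩ := exists_inner_eq_of_le ((restrictL2 hr2 A).comp W.subtype)
    ((L - B).toLinearMap.comp W.subtype) fun φ => hbound φ φ.2
  refine ⟨k, fun φ hφ => ?_⟩
  have hkφ : L φ - B φ = inner ℝ k (restrictL2 hr2 A φ) := hk ⟨φ, hφ⟩
  rw [← hB', ← sub_eq_iff_eq_add', hkφ, L2.inner_def]
  refine integral_congr_ae ?_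
  filter_upwards [coeFn_restrictL2 hr2 A φ] with x hx
  rw [hx]

theorem exists_multiplier [CompleteSpace E] (hg : IsPowerLaw r g) (hr : 2 ≤ r)
    (hrs : r.HolderConjugate s) {L : Lp E (ENNReal.ofReal r) μ →L[ℝ] ℝ}
    {W : Submodule ℝ (Lp E (ENNReal.ofReal r) μ)} {u : Lp E (ENNReal.ofReal r) μ}
    (hmin : ∀ φ ∈ W, totalEnergy g L u ≤ totalEnergy g L (u + φ)) {A : Set α}
    (hA : MeasurableSet A) {R : ℝ} (hR : ∀ x ∈ A, ‖u x‖ ≤ R)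
    (hcont : ∀ x ∉ A, ContinuousAt g (‖u x‖ ^ 2)) :
    ∃ Λ : Lp E (ENNReal.ofReal s) μ, (∀ᵐ x ∂μ, x ∉ A → Λ x = darcyField g u x) ∧
      ∀ φ ∈ W, ∫ x, inner ℝ (Λ x) (φ x) ∂μ = L φ := by
  classical
  have := hrs.symm.ennrealOfReal
  have hs2 : ENNReal.ofReal s ≤ 2 := by
    have hs : s ≤ 2 := by
      rw [hrs.conjugate_eq, div_le_iff₀ hrs.sub_one_pos]
      linarith
    simpa using ENNReal.ofReal_le_ofReal hs
  obtain ⟨k, hk⟩ := hg.exists_defect_representation hr hmin hA hR hcont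
  have hΛ : MemLp (A.piecewise k (darcyField g u)) (ENNReal.ofReal s) μ :=
    MemLp.piecewise hA ((Lp.memLp k).mono_exponent hs2)
      ((hg.memLp_darcyField hrs (Lp.memLp u)).restrict Aᶜ)
  obtain ⟨Λ, hcoe⟩ : ∃ Λ : Lp E (ENNReal.ofReal s) μ, Λ =ᵐ[μ] A.piecewise k (darcyField g u) :=
    ⟨hΛ.toLp, hΛ.coeFn_toLp⟩
  refine ⟨Λ, hcoe.mono fun x hx hxA => ?_, fun φ hφ => ?_⟩
  · rw [hx, piecewise_eq_of_notMem _ _ _ hxA]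
  have hint : Integrable (fun x => inner ℝ (Λ x) (φ x)) μ :=
    integrable_inner_of_memLp (Lp.memLp _) (Lp.memLp φ)
  rw [hk φ hφ, ← integral_add_compl hA hint, add_comm]
  congr 1
  · refine setIntegral_congr_ae hA.compl (hcoe.mono fun x hx hxA => ?_)
    rw [hx, piecewise_eq_of_notMem _ _ _ hxA]
  · refine setIntegral_congr_ae hA (hcoe.mono fun x hx hxA => ?_)
    rw [hx, piecewise_eq_of_mem _ _ _ hxA]

end IsPowerLaw

end EulerLagrange

section JoinedLaw

variable {r : ℝ} {φ₁ φ₂ : ℝ → ℝ} {a : ℝ}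

/-- The multiplier of the single law that `φ₁` and `φ₂` define together. It is `φ₁ 0` on the
negative half-line, so that it is monotone on `ℝ`, and it takes the value `φ₂ 1` at the jump. -/
noncomputable def joinedLaw (φ₁ φ₂ : ℝ → ℝ) (a : ℝ) : ℝ := if a < 1 then φ₁ (max a 0) else φ₂ a

theorem joinedLaw_of_lt (h0 : 0 ≤ a) (h1 : a < 1) : joinedLaw φ₁ φ₂ a = φ₁ a := by
  rw [joinedLaw, if_pos h1, max_eq_left h0]

theorem joinedLaw_of_nonpos (h0 : a ≤ 0) : joinedLaw φ₁ φ₂ a = φ₁ 0 := by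
  rw [joinedLaw, if_pos (h0.trans_lt one_pos), max_eq_right h0]

theorem joinedLaw_of_one_le (h1 : 1 ≤ a) : joinedLaw φ₁ φ₂ a = φ₂ a := if_neg h1.not_gt

theorem Psi_eq_primitive_joinedLaw (ha : 0 ≤ a) :
    Psi φ₁ φ₂ a = primitive (joinedLaw φ₁ φ₂) a := by
  unfold Psi primitive
  split_ifs with h1
  · refine intervalIntegral.integral_congr_ae ?_
    filter_upwards [compl_mem_ae_iff.2 (measure_singleton (1 : ℝ))] with t ht hmem
    rw [uIoc_of_ge h1] at hmem
    rw [joinedLaw_of_lt (ha.trans hmem.1.le) (hmem.2.lt_of_ne ht)]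
  · refine intervalIntegral.integral_congr fun t ht => ?_
    rw [uIcc_of_le (not_le.1 h1).le] at ht
    simp only [joinedLaw_of_one_le ht.1]

namespace AdmissibleLaws

theorem continuousAt_joinedLaw (h : AdmissibleLaws r φ₁ φ₂) (ha : a ≠ 1) :
    ContinuousAt (joinedLaw φ₁ φ₂) a := by
  rcases ha.lt_or_gt with ha | ha
  · have hcont : ContinuousOn (fun t => φ₁ (max t 0)) (Iio 1) :=
      h.continuous₁.comp (by fun_prop) fun t ht =>
        ⟨le_max_right _ _, max_le (le_of_lt ht) zero_le_one⟩
    exact (hcont.continuousAt (Iio_mem_nhds ha)).congr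
      (eventuallyEq_of_mem (Iio_mem_nhds ha) fun t ht => (if_pos ht).symm)
  · exact (h.continuous₂.continuousAt (Ici_mem_nhds ha)).congr
      (eventuallyEq_of_mem (Ici_mem_nhds ha) fun t ht => (joinedLaw_of_one_le ht).symm)

theorem monotone_joinedLaw (h : AdmissibleLaws r φ₁ φ₂) (hlam : φ₁ 1 ≤ φ₂ 1) :
    Monotone (joinedLaw φ₁ φ₂) := by
  have hmem : ∀ t : ℝ, t < 1 → max t 0 ∈ Icc (0 : ℝ) 1 := fun t ht =>
    ⟨le_max_right _ _, max_le ht.le zero_le_one⟩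
  intro a b hab
  unfold joinedLaw
  split_ifs with ha hb hb
  · exact h.monotone₁ (hmem a ha) (hmem b hb) (max_le_max_right 0 hab)
  · have hb' := not_lt.1 hb
    calc φ₁ (max a 0) ≤ φ₁ 1 :=
          h.monotone₁ (hmem a ha) (right_mem_Icc.2 zero_le_one) (hmem a ha).2
      _ ≤ φ₂ 1 := hlam
      _ ≤ φ₂ b := h.monotone₂ self_mem_Ici hb' hb'
  · exact absurd (hab.trans_lt hb) ha
  · exact h.monotone₂ (not_lt.1 ha) (not_lt.1 hb) hab

theorem joinedLaw_nonneg (h : AdmissibleLaws r φ₁ φ₂) (hlam : φ₁ 1 ≤ φ₂ 1) (a : ℝ) :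
    0 ≤ joinedLaw φ₁ φ₂ a :=
  calc 0 ≤ φ₁ 0 := h.nonneg₁ 0 (left_mem_Icc.2 zero_le_one)
    _ = joinedLaw φ₁ φ₂ (min a 0) := (joinedLaw_of_nonpos (min_le_right _ _)).symm
    _ ≤ joinedLaw φ₁ φ₂ a := h.monotone_joinedLaw hlam (min_le_left _ _)

theorem joinedLaw_pos (h : AdmissibleLaws r φ₁ φ₂) (hlam : φ₁ 1 ≤ φ₂ 1) (ha : 0 < a) :
    0 < joinedLaw φ₁ φ₂ a := by
  have hmem : min a (1 / 2) ∈ Ioo (0 : ℝ) 1 :=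
    ⟨lt_min ha one_half_pos, (min_le_right _ _).trans_lt one_half_lt_one⟩
  calc 0 < φ₁ (min a (1 / 2)) := h.pos₁ _ hmem
    _ = joinedLaw φ₁ φ₂ (min a (1 / 2)) := (joinedLaw_of_lt hmem.1.le hmem.2).symm
    _ ≤ joinedLaw φ₁ φ₂ a := h.monotone_joinedLaw hlam (min_le_left _ _)

theorem exists_joinedLaw_sq_le (h : AdmissibleLaws r φ₁ φ₂) (hlam : φ₁ 1 ≤ φ₂ 1) (hr : 2 ≤ r) :
    ∃ K : ℝ, ∀ t : ℝ, 0 ≤ t → joinedLaw φ₁ φ₂ (t ^ 2) ≤ K * (1 + t) ^ (r - 2) := by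
  obtain ⟨_, C, -, hC, hgrowth⟩ := h.growth
  refine ⟨2 * C, fun t ht => ?_⟩
  have hone : 1 ≤ (1 + t) ^ (r - 2) := Real.one_le_rpow (by linarith) (by linarith)
  have hpow : (max t 1 ^ 2) ^ ((r - 2) / 2) ≤ (1 + t) ^ (r - 2) := by
    rw [← Real.rpow_natCast_mul (by positivity), Nat.cast_ofNat, mul_div_cancel₀ _ two_ne_zero]
    exact Real.rpow_le_rpow (by positivity) (max_le (by linarith) (by linarith)) (by linarith)
  have hmax : 1 ≤ max t 1 ^ 2 := one_le_pow₀ (le_max_right _ _)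
  calc joinedLaw φ₁ φ₂ (t ^ 2) ≤ joinedLaw φ₁ φ₂ (max t 1 ^ 2) :=
        h.monotone_joinedLaw hlam (pow_le_pow_left₀ ht (le_max_left _ _) 2)
    _ = φ₂ (max t 1 ^ 2) := joinedLaw_of_one_le hmax
    _ ≤ C * (1 + (max t 1 ^ 2) ^ ((r - 2) / 2)) := (hgrowth _ hmax).2
    _ ≤ C * ((1 + t) ^ (r - 2) + (1 + t) ^ (r - 2)) := by gcongr
    _ = 2 * C * (1 + t) ^ (r - 2) := by ring

theorem isPowerLaw_joinedLaw (h : AdmissibleLaws r φ₁ φ₂) (hlam : φ₁ 1 ≤ φ₂ 1) (hr : 2 ≤ r) :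
    IsPowerLaw r (joinedLaw φ₁ φ₂) where
  monotone := h.monotone_joinedLaw hlam
  nonneg := h.joinedLaw_nonneg hlam
  pos _ ha := h.joinedLaw_pos hlam ha
  growth_le := h.exists_joinedLaw_sq_le hlam hr
  le_growth := by
    obtain ⟨c, _, hc, -, hgrowth⟩ := h.growth
    refine ⟨c, hc, fun a ha => ?_⟩
    rw [joinedLaw_of_one_le ha]
    exact (hgrowth a ha).1

end AdmissibleLaws

end JoinedLaw

section FieldEnergy

variable {α E : Type*} [MeasurableSpace α] [NormedAddCommGroup E] [InnerProductSpace ℝ E]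
  {μ : Measure α} {r s : ℝ} {φ₁ φ₂ : ℝ → ℝ}

/-- The energy `∫ Ψ(|u|²) - ∫ f₀ · u` of a field `u` on an arbitrary measure space; `energy` is its
instance `μ = volume.restrict Ω`, `u = v + û`. -/
noncomputable def fieldEnergy (φ₁ φ₂ : ℝ → ℝ) (μ : Measure α) (f₀ u : α → E) : ℝ :=
  ∫ x, Psi φ₁ φ₂ (‖u x‖ ^ 2) ∂μ - ∫ x, inner ℝ (f₀ x) (u x) ∂μ

/-- `Λ` is a selection of the multi-valued law of `u`: it is free on the interface `|u| = 1`. -/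
def IsLawSelection (φ₁ φ₂ : ℝ → ℝ) (μ : Measure α) (u Λ : α → E) : Prop :=
  ∀ᵐ x ∂μ, (‖u x‖ < 1 → Λ x = φ₁ (‖u x‖ ^ 2) • u x) ∧ (1 < ‖u x‖ → Λ x = φ₂ (‖u x‖ ^ 2) • u x)

theorem fieldEnergy_eq_totalEnergy [Fact (1 ≤ ENNReal.ofReal r)] {f₀ : α → E}
    {L : Lp E (ENNReal.ofReal r) μ →L[ℝ] ℝ}
    (hL : ∀ u : Lp E (ENNReal.ofReal r) μ, L u = ∫ x, inner ℝ (f₀ x) (u x) ∂μ)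
    (u : Lp E (ENNReal.ofReal r) μ) :
    fieldEnergy φ₁ φ₂ μ f₀ u = totalEnergy (joinedLaw φ₁ φ₂) L u := by
  simp only [fieldEnergy, totalEnergy, totalDissipation, hL,
    Psi_eq_primitive_joinedLaw (sq_nonneg _)]

theorem AdmissibleLaws.integrable_Psi [IsFiniteMeasure μ] (h : AdmissibleLaws r φ₁ φ₂)
    (hlam : φ₁ 1 ≤ φ₂ 1) (hr : 2 ≤ r) (u : Lp E (ENNReal.ofReal r) μ) :
    Integrable (fun x => Psi φ₁ φ₂ (‖u x‖ ^ 2)) μ := by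
  simp only [Psi_eq_primitive_joinedLaw (sq_nonneg _)]
  exact (h.isPowerLaw_joinedLaw hlam hr).integrable_primitive (by linarith) (Lp.memLp u)

theorem AdmissibleLaws.exists_multiplier [CompleteSpace E] [IsFiniteMeasure μ]
    [Fact (1 ≤ ENNReal.ofReal r)] (h : AdmissibleLaws r φ₁ φ₂) (hlam : φ₁ 1 ≤ φ₂ 1)
    (hr : 2 ≤ r) (hrs : r.HolderConjugate s) {L : Lp E (ENNReal.ofReal r) μ →L[ℝ] ℝ}
    {W : Submodule ℝ (Lp E (ENNReal.ofReal r) μ)} {u : Lp E (ENNReal.ofReal r) μ}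
    (hmin : ∀ φ ∈ W, totalEnergy (joinedLaw φ₁ φ₂) L u ≤ totalEnergy (joinedLaw φ₁ φ₂) L (u + φ)) :
    ∃ Λ : Lp E (ENNReal.ofReal s) μ, IsLawSelection φ₁ φ₂ μ u Λ ∧
      ∀ φ ∈ W, ∫ x, inner ℝ (Λ x) (φ x) ∂μ = L φ := by
  have hA : MeasurableSet {x | ‖u x‖ = 1} :=
    (Lp.stronglyMeasurable u).norm.measurable (measurableSet_singleton 1)
  obtain ⟨Λ, hΛ, hpair⟩ := (h.isPowerLaw_joinedLaw hlam hr).exists_multiplier hr hrs hmin hA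
    (R := 1) (fun x hx => hx.le) fun x hx =>
      h.continuousAt_joinedLaw fun hsq =>
        hx ((pow_eq_one_iff_of_nonneg (norm_nonneg _) two_ne_zero).1 hsq)
  refine ⟨Λ, hΛ.mono fun x hx => ⟨fun hlt => ?_, fun hgt => ?_⟩, hpair⟩
  · rw [hx hlt.ne, darcyField, joinedLaw_of_lt (sq_nonneg _)
      (pow_lt_one₀ (norm_nonneg _) hlt two_ne_zero)]
  · rw [hx hgt.ne', darcyField, joinedLaw_of_one_le (one_le_pow₀ hgt.le)]

end FieldEnergy

section Fracture

variable {d : ℕ} {Ω Sv Sp : Set (Space d)} {r : ℝ} {φ₁ φ₂ : ℝ → ℝ}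

theorem isClosed_V [Fact (1 ≤ ENNReal.ofReal r)] (Ω Sp : Set (Space d)) (hr : 2 ≤ r) :
    IsClosed (V Ω Sp r hr : Set (VecLp Ω r)) := by
  have hrs : r.HolderConjugate (conjExp r) := Real.HolderConjugate.conjExponent (by linarith)
  have := hrs.symm.ennrealOfReal
  have hV : (V Ω Sp r hr : Set (VecLp Ω r)) = ⋂ (ψ : Space d → ℝ) (G : Space d → Space d)
      (_ : MemW0 Ω Sp (conjExp r) ψ G), {φ : VecLp Ω r | pairing Ω G φ = 0} := by
    ext φ
    simp only [mem_iInter]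
    rfl
  rw [hV]
  refine isClosed_iInter fun ψ => isClosed_iInter fun G => isClosed_iInter fun hψ => ?_
  obtain ⟨L, hL⟩ := exists_clm_eq_integral_inner (p := ENNReal.ofReal r) hψ.isSobolev.memLp_grad
  simp only [pairing, ← hL]
  exact isClosed_eq L.continuous continuous_const

theorem HasFluxData.add_mem_V {hr : 2 ≤ r} {q u₀ : Space d → ℝ} {u v : VecLp Ω r}
    (h : HasFluxData Ω Sv Sp r q u₀ u) (hv : v ∈ V Ω Sp r hr) :
    HasFluxData Ω Sv Sp r q u₀ (v + u) := by
  intro ψ G g hψ hg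
  have hint := fun w : VecLp Ω r =>
    integrable_inner_of_conj Ω hr hψ.isSobolev.memLp_grad (Lp.memLp w)
  have hadd : pairing Ω G (v + u : VecLp Ω r) = pairing Ω G v + pairing Ω G u := by
    rw [pairing, pairing, pairing, ← integral_add (hint v) (hint u)]
    refine integral_congr_ae ?_
    filter_upwards [Lp.coeFn_add v u] with x hx
    rw [hx, Pi.add_apply, inner_add_right]
  rw [hadd, hv ψ G hψ, zero_add]
  exact h ψ G g hψ hg

theorem mem_combinedLaw {u : VecLp Ω r} {Λ : VecLp Ω (conjExp r)}
    (hΛ : IsLawSelection φ₁ φ₂ (volume.restrict Ω) u Λ) : Λ ∈ combinedLaw φ₁ φ₂ u := by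
  refine ⟨Λ, hΛ.mono fun x hx => ?_⟩
  rcases lt_trichotomy ‖u x‖ 1 with hlt | heq | hgt
  · simp [bulkLaw, hlt, hlt.le, hlt.ne, hx.1 hlt]
  · simp [bulkLaw, heq]
  · simp [bulkLaw, hgt, hgt.le, hgt.ne', hx.2 hgt]

end Fracture

theorem theorem4p1_general {α E : Type*} [MeasurableSpace α] {μ : Measure α} [IsFiniteMeasure μ]
    [NormedAddCommGroup E] [InnerProductSpace ℝ E] [CompleteSpace E] {r s : ℝ} (hr : 2 ≤ r)
    (hrs : r.HolderConjugate s) [Fact (1 ≤ ENNReal.ofReal r)] {φ₁ φ₂ : ℝ → ℝ}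
    (hφ : AdmissibleLaws r φ₁ φ₂) (hlam : φ₁ 1 ≤ φ₂ 1)
    {W : Submodule ℝ (Lp E (ENNReal.ofReal r) μ)}
    (hW : IsClosed (W : Set (Lp E (ENNReal.ofReal r) μ)))
    (f₀ : Lp E (ENNReal.ofReal s) μ) (uhat : Lp E (ENNReal.ofReal r) μ) :
    (∀ u : Lp E (ENNReal.ofReal r) μ, Integrable (fun x => Psi φ₁ φ₂ (‖u x‖ ^ 2)) μ ∧
      Integrable (fun x => inner ℝ (f₀ x) (u x)) μ) ∧
    ∃ v : W,
      (∀ w : W, fieldEnergy φ₁ φ₂ μ f₀ (v + uhat : Lp E (ENNReal.ofReal r) μ)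
        ≤ fieldEnergy φ₁ φ₂ μ f₀ (w + uhat : Lp E (ENNReal.ofReal r) μ)) ∧
      {w : W | IsStrongLocalMinimizer
        (fun w : W => fieldEnergy φ₁ φ₂ μ f₀ (w + uhat : Lp E (ENNReal.ofReal r) μ)) w} = {v} ∧
      (∀ w : W, IsDirectionalLocalMinimizer
        (fun w : W => fieldEnergy φ₁ φ₂ μ f₀ (w + uhat : Lp E (ENNReal.ofReal r) μ)) w →
          w = v) ∧
      ∃ Λ : Lp E (ENNReal.ofReal s) μ,
        IsLawSelection φ₁ φ₂ μ (v + uhat : Lp E (ENNReal.ofReal r) μ) Λ ∧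
        ∀ φ ∈ W, ∫ x, inner ℝ (Λ x) (φ x) ∂μ = ∫ x, inner ℝ (f₀ x) (φ x) ∂μ := by
  have := hrs.symm.ennrealOfReal
  obtain ⟨L, hL⟩ := exists_clm_eq_integral_inner (p := ENNReal.ofReal r) (Lp.memLp f₀)
  obtain ⟨v, hmin, huniq, hdir⟩ := (hφ.isPowerLaw_joinedLaw hlam hr)
    |>.exists_unique_localMinimizer_totalEnergy (by linarith) L hW uhat
  have hminW : ∀ φ ∈ W, totalEnergy (joinedLaw φ₁ φ₂) L (v + uhat)
      ≤ totalEnergy (joinedLaw φ₁ φ₂) L (v + uhat + φ) := fun φ hφW => by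
    have hle := hmin (v + ⟨φ, hφW⟩)
    rwa [Submodule.coe_add, add_right_comm] at hle
  obtain ⟨Λ, hΛ, hpair⟩ := hφ.exists_multiplier hlam hr hrs hminW
  simp only [fieldEnergy_eq_totalEnergy hL, ← hL]
  exact ⟨fun u =>
      ⟨hφ.integrable_Psi hlam hr u, integrable_inner_of_memLp (Lp.memLp f₀) (Lp.memLp u)⟩,
    v, hmin, huniq, hdir, Λ, hΛ, hpair⟩

end AdaptiveDarcy

theorem theorem4p1 (d : ℕ) (hd : 1 ≤ d) (Ω Sv Sp : Set (AdaptiveDarcy.Space d))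
    (hΩ : AdaptiveDarcy.IsFracture Ω Sv Sp)
    (r : ℝ) (hr : 2 ≤ r) (φ₁ φ₂ : ℝ → ℝ) (hφ : AdaptiveDarcy.AdmissibleLaws r φ₁ φ₂)
    (hlam : φ₁ 1 ≤ φ₂ 1)
    (q u₀ : AdaptiveDarcy.Space d → ℝ)
    (hq : MemLp q (ENNReal.ofReal r) (volume.restrict Ω))
    (hu₀ : MemLp u₀ (ENNReal.ofReal r) ((AdaptiveDarcy.surface d).restrict Sv))
    (f₀ : AdaptiveDarcy.VecLp Ω (AdaptiveDarcy.conjExp r))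
    (uhat : AdaptiveDarcy.VecLp Ω r) :
    -- the energy is given by convergent integrals on all of `V`
    (∀ v : AdaptiveDarcy.V Ω Sp r hr,
      Integrable (fun x => AdaptiveDarcy.Psi φ₁ φ₂
        (‖((v : AdaptiveDarcy.VecLp Ω r) + uhat) x‖ ^ 2)) (volume.restrict Ω) ∧
      Integrable (fun x => (inner ℝ (f₀ x) (((v : AdaptiveDarcy.VecLp Ω r) + uhat) x) : ℝ))
        (volume.restrict Ω)) ∧
    ∃ v : AdaptiveDarcy.V Ω Sp r hr,
      -- `v` is a global minimizer
      (∀ w : AdaptiveDarcy.V Ω Sp r hr,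
        AdaptiveDarcy.energy φ₁ φ₂ f₀ uhat v ≤ AdaptiveDarcy.energy φ₁ φ₂ f₀ uhat w) ∧
      -- `v` is the only local minimizer
      {w : AdaptiveDarcy.V Ω Sp r hr | AdaptiveDarcy.IsStrongLocalMinimizer
        (AdaptiveDarcy.energy φ₁ φ₂ f₀ uhat) w} = {v} ∧
      (∀ w : AdaptiveDarcy.V Ω Sp r hr, AdaptiveDarcy.IsDirectionalLocalMinimizer
        (AdaptiveDarcy.energy φ₁ φ₂ f₀ uhat) w → w = v) ∧
      -- `v` solves the reduced weak problem
      AdaptiveDarcy.SolvesReducedProblem φ₁ φ₂ f₀ uhat v ∧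
      -- `v + û` carries the flux data of `û`
      (AdaptiveDarcy.HasFluxData Ω Sv Sp r q u₀ uhat →
        AdaptiveDarcy.HasFluxData Ω Sv Sp r q u₀ ((v : AdaptiveDarcy.VecLp Ω r) + uhat)) := by
  have : IsFiniteMeasure (volume.restrict Ω) :=
    isFiniteMeasure_restrict.2 hΩ.isBounded.measure_lt_top.ne
  have : Fact (1 ≤ ENNReal.ofReal r) := ⟨ENNReal.one_le_ofReal.2 (by linarith)⟩
  obtain ⟨hint, v, hmin, huniq, hdir, Λ, hΛ, hpair⟩ := AdaptiveDarcy.theorem4p1_general hr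
    (Real.HolderConjugate.conjExponent (by linarith)) hφ hlam (AdaptiveDarcy.isClosed_V Ω Sp hr)
    f₀ uhat
  exact ⟨fun v => hint _, v, hmin, huniq, hdir, ⟨Λ, AdaptiveDarcy.mem_combinedLaw hΛ,
    fun φ => hpair φ φ.2⟩,
    fun h => h.add_mem_V v.2⟩
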